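/- **Definitions.** A $\mathbb Z^2$-triangle is a triple of points of $\mathbb Z^2$; two are $\mathbb Z^2$-congruent if one is carried to the other (up to the order of vertices) by a composition of shifts of $\mathbb Z^2$, rotations by multiples of $\pi/2$ and reflections in the coordinate axes or bisectrices. Let $D^2$ be attainable, i.e. a positive integer of the form $m^2+n^2$. A *minimizing triangle* for $D^2$ is a $\mathbb Z^2$-triangle of the smallest area among those with all side-lengths $\ge D$ and all angles $\le\pi/2$; an *M-triangle* is a triangle that is minimizing for some attainable value. The value $D^2$ is *sliding* if there are two minimizing triangles $OWA$, $OWB$ with a common side $OW$ and distinct third vertices $A,B$ in the same half-plane relative to $OW$, which are not the two halves of one rectangle with side $OW$. A non-sliding $D^2$ is of *Class A* if all its minimizing triangles are $\mathbb Z^2$-congruent; of *Class B0* if they all have the same side-lengths $(\ell_0\le\ell_1\le\ell_2)$ but are not all $\mathbb Z^2$-congruent; of *Class B1* if at least two triples of side-lengths occur and minimizing triangles with equal triples are $\mathbb Z^2$-congruent; of *Class B2* if at least two triples occur and some two minimizing triangles with equal triples are not $\mathbb Z^2$-congruent. The *signature* of a triangle is $(a,b)=(\ell_1^2-\ell_0^2,\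 \ell_2^2-\ell_1^2)$. Let $\zeta=(\sqrt{-1}+\sqrt3)/2$, a primitive 12th root of unity. To the triangle with vertices $(0,0),(m,n),(k,l)$ (and to its shifts) assign $m\zeta^{10}+n\zeta+k\zeta^2+l\zeta^5\in\mathbb Z[\zeta]$. A $\mathbb Z$-*indexation* of a coset $\alpha\,\mathbb U[\zeta]$ ($\alpha\neq0$) of the unit group is a sequence $(x_j)_{j\in\mathbb Z}$ of triangles from the coset in which, up to torsion units $\zeta^i$, either each step $x_j\mapsto x_{j+1}$ or each step $x_{j+1}\mapsto x_j$ is multiplication by $1+\zeta$. A set of nonzero cosets together with a choice of an indexation for each of them is *compatible* if all M-triangles with the same index $j$ have the same area; a *family* is a set of nonzero cosets that is maximal, for inclusion, among those admitting a compatible choice. For a family with a compatible choice, $D_j^2$ denotes the shortest squared side-length among its M-triangles with index $j$ (if there are any). **Theorem 3.** 1. Each of Classes A, B0, B1, B2 contains infinitely many values $D^2$, and each non-sliding attainable $D^2$ lies in exactly one of them. 2. The assignment above is a bijection between the $\mathbb Z^2$-triangles with first vertex $(0,0)$ and $\mathbb Z[\zeta]$, and triangles that differ by a torsion unit are $\mathbb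 Z^2$-congruent. Each nonzero coset of $\mathbb U[\zeta]$ has an indexation. In any indexation $(x_j)$ of it, each triangle of the coset equals, up to a torsion unit, exactly one $x_j$; there are $a,b$ such that $x_j$ has signature $(a,b)$ for even $j$ and $(b,a)$ for odd $j$; and all but finitely many $x_j$ are M-triangles. Thus the $\mathbb Z^2$-triangles (other than three coinciding points) are partitioned into doubly infinite sequences with alternating signatures, identified with the nonzero cosets. 3. The nonzero cosets are partitioned into families. Each family is finite. For each compatible choice of indexations there are infinitely many values $D_j^2$; moreover, there is exactly one of the Classes A, B0, B1, B2 such that, for each compatible choice, $D_j^2$ is defined and belongs to this class for all but finitely many $j\in\mathbb Z$. Each of the four classes corresponds in this sense to some family. For each of B0, B1, B2 and each $N$ there is a corresponding family containing at least $N$ cosets, no two of which contain $\mathbb Z^2$-congruent triangles. -/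

import Mathlib

noncomputable section

namespace HardCore

/-! ### Lattice triangles -/

/-- A `ℤ²`-triangle, given by its three vertices (degenerate triples are allowed here). -/
abbrev Tri := Fin 3 → ℤ × ℤ

/-- Squared Euclidean distance between two lattice sites. -/
def sqDist (p q : ℤ × ℤ) : ℕ := (p.1 - q.1).natAbs ^ 2 + (p.2 - q.2).natAbs ^ 2

/-- The determinant of two lattice vectors. -/
def cross (p q : ℤ × ℤ) : ℤ := p.1 * q.2 - p.2 * q.1

/-- Squared length of the side opposite to the vertex `T i`. -/
def sideSq (T : Tri) (i : Fin 3) : ℕ := sqDist (T (i + 1)) (T (i + 2))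

/-- Twice the area of a triangle. -/
def dblArea (T : Tri) : ℕ := (cross (T 1 - T 0) (T 2 - T 0)).natAbs

/-- The shortest squared side-length `ℓ₀²`. -/
def shortSq (T : Tri) : ℕ := min (sideSq T 0) (min (sideSq T 1) (sideSq T 2))

/-- The middle squared side-length `ℓ₁²` (the median of the three). -/
def midSq (T : Tri) : ℕ :=
  max (min (sideSq T 0) (sideSq T 1)) (min (max (sideSq T 0) (sideSq T 1)) (sideSq T 2))

/-- The longest squared side-length `ℓ₂²`. -/
def longSq (T : Tri) : ℕ := max (sideSq T 0) (max (sideSq T 1) (sideSq T 2))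

/-- The type `(ℓ₀², ℓ₁², ℓ₂²)`, with `ℓ₀ ≤ ℓ₁ ≤ ℓ₂`. -/
def sideType (T : Tri) : ℕ × ℕ × ℕ := (shortSq T, midSq T, longSq T)

/-- The signature `(a, b) = (ℓ₁² - ℓ₀², ℓ₂² - ℓ₁²)`. -/
def signature (T : Tri) : ℤ × ℤ :=
  ((midSq T : ℤ) - (shortSq T : ℤ), (longSq T : ℤ) - (midSq T : ℤ))

/-- The symmetries of the lattice: shifts, composed with rotations by multiples of `π/2` and
reflections in the coordinate axes and in the bisectrices. -/
def latticeSym (s t : ℤˣ) (w : Bool) (c p : ℤ × ℤ) : ℤ × ℤ :=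
  c + if w then ((s : ℤ) * p.2, (t : ℤ) * p.1) else ((s : ℤ) * p.1, (t : ℤ) * p.2)

/-- `ℤ²`-congruence of triangles (the order of the vertices is irrelevant). -/
def Z2Congruent (T T' : Tri) : Prop :=
  ∃ (s t : ℤˣ) (w : Bool) (c : ℤ × ℤ) (π : Equiv.Perm (Fin 3)),
    ∀ i, T' i = latticeSym s t w c (T (π i))

/-! ### The minimization problem and the classes of values `D²` -/

/-- `d = D²` is attainable: a positive sum of two squares. -/
def Attainable (d : ℕ) : Prop := 0 < d ∧ ∃ m n : ℕ, d = m ^ 2 + n ^ 2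

/-- All side-lengths are at least `D` (where `d = D²`) and all angles are at most `π/2`; the
latter is written by means of the law of cosines. -/
def Admissible (d : ℕ) (T : Tri) : Prop :=
  (∀ i, d ≤ sideSq T i) ∧ ∀ i, sideSq T i ≤ sideSq T (i + 1) + sideSq T (i + 2)

/-- `T` is a minimizing triangle for `d = D²`: it has the smallest area among all admissible
triangles. -/
def IsMin (d : ℕ) (T : Tri) : Prop :=
  Admissible d T ∧ ∀ T', Admissible d T' → dblArea T ≤ dblArea T'

/-- M-triangles: minimizing triangles for some attainable value `D²`. -/
def IsMTri (T : Tri) : Prop := ∃ d, Attainable d ∧ IsMin d T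

/-- Sliding: two minimizing triangles `OWA`, `OWB` share the side `OW` and have distinct third
vertices in the same half-plane relative to `OW`.  The last two conditions say that `OWA` and
`OWB` are not the two halves of one rectangle with side `OW`: those generate one and the same
sub-lattice and are not in competition (this happens for `D² = 1, 2, 5, 10`). -/
def Sliding (d : ℕ) : Prop :=
  ∃ O W A B : ℤ × ℤ, IsMin d ![O, W, A] ∧ IsMin d ![O, W, B] ∧ A ≠ B ∧
    0 < cross (W - O) (A - O) * cross (W - O) (B - O) ∧ A - B ≠ W - O ∧ B - A ≠ W - O

/-- The names of the classes. -/
inductive DClass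
  | A
  | B0
  | B1
  | B2

/-- All minimizing triangles have the same side-lengths. -/
def UniqueType (d : ℕ) : Prop := ∀ T T', IsMin d T → IsMin d T' → sideType T = sideType T'

/-- Any two minimizing triangles with the same side-lengths are `ℤ²`-congruent. -/
def UniqueImplementation (d : ℕ) : Prop :=
  ∀ T T', IsMin d T → IsMin d T' → sideType T = sideType T' → Z2Congruent T T'

/-- The value `d = D²` belongs to the given class. -/
def InClass (K : DClass) (d : ℕ) : Prop :=
  Attainable d ∧ ¬ Sliding d ∧
    match K with
    | .A => ∀ T T', IsMin d T → IsMin d T' → Z2Congruent T T'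
    | .B0 => UniqueType d ∧ ∃ T T', IsMin d T ∧ IsMin d T' ∧ ¬ Z2Congruent T T'
    | .B1 => ¬ UniqueType d ∧ UniqueImplementation d
    | .B2 => ¬ UniqueType d ∧ ¬ UniqueImplementation d

/-! ### The cyclotomic ring `ℤ[ζ]`, cosets of its unit group, double sequences -/

/-- The primitive 12-th root of unity `(√-1 + √3) / 2`. -/
def zetaC : ℂ := (Complex.I + (Real.sqrt 3 : ℂ)) / 2

/-- The cyclotomic ring `ℤ[ζ]`. -/
abbrev ZZeta := Algebra.adjoin ℤ ({zetaC} : Set ℂ)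

/-- `ζ` as an element of `ℤ[ζ]`. -/
def zeta : ZZeta := ⟨zetaC, Algebra.subset_adjoin rfl⟩

/-- The algebraic integer `m ζ¹⁰ + n ζ + k ζ² + l ζ⁵` of the triangle with vertices `(0,0)`,
`(m,n)`, `(k,l)`, and of all its shifts. -/
def elt (T : Tri) : ZZeta :=
  ((T 1 - T 0).1 : ZZeta) * zeta ^ 10 + ((T 1 - T 0).2 : ZZeta) * zeta +
    ((T 2 - T 0).1 : ZZeta) * zeta ^ 2 + ((T 2 - T 0).2 : ZZeta) * zeta ^ 5

/-- The cosets of the unit group of `ℤ[ζ]`, including the coset of `0`. -/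
abbrev Coset := Associates ZZeta

/-- The coset of (the algebraic integer of) a triangle. -/
def coset (T : Tri) : Coset := Associates.mk (elt T)

/-- `x` is a `ℤ`-indexation of the coset `c` as a double sequence of triangles, taken up to
multiplication by the torsion units `ζ ^ i`: a step along the sequence, in one of the two
directions, is multiplication by the unit `1 + ζ`. -/
def IsIndexation (c : Coset) (x : ℤ → Tri) : Prop :=
  (∀ j, coset (x j) = c) ∧
    ((∀ j, ∃ i : ℕ, elt (x (j + 1)) = zeta ^ i * (1 + zeta) * elt (x j)) ∨
      (∀ j, ∃ i : ℕ, elt (x j) = zeta ^ i * (1 + zeta) * elt (x (j + 1))))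

/-! ### Families of cosets -/

/-- `X` is a choice of indexations for all cosets of `F` (which are different from the coset of
`0`) such that all M-triangles with the same index have the same area. -/
def IsCompatible (F : Set Coset) (X : Coset → ℤ → Tri) : Prop :=
  (∀ c ∈ F, c ≠ 0 ∧ IsIndexation c (X c)) ∧
    ∀ c ∈ F, ∀ c' ∈ F, ∀ j, IsMTri (X c j) → IsMTri (X c' j) →
      dblArea (X c j) = dblArea (X c' j)

/-- A maximal family: a set of cosets that is maximal (for inclusion) among those that admit a
compatible choice of indexations. -/
def IsMaxFamily (F : Set Coset) : Prop := Maximal (fun G => ∃ X, IsCompatible G X) F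

/-- The shortest squared side-lengths of the M-triangles of the family with index `j`; the least
element of this set is `D_j²`. -/
def shortSides (F : Set Coset) (X : Coset → ℤ → Tri) (j : ℤ) : Set ℕ :=
  {n | ∃ c ∈ F, IsMTri (X c j) ∧ n = shortSq (X c j)}

/-- The family `F` corresponds to the class `K`: for every compatible choice of indexations and
all but finitely many `j`, the value `D_j²` is defined and belongs to `K`. -/
def FamilyOfClass (F : Set Coset) (K : DClass) : Prop :=
  ∀ X, IsCompatible F X → {j : ℤ | ¬ ∃ d, IsLeast (shortSides F X j) d ∧ InClass K d}.Finite

end HardCore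

end

open HardCore

/-! Put `u = m + n i` and `v = k + l i`. Then a triangle becomes `u ζ¹⁰ + v ζ²`, and `ζ¹⁰, ζ²` is a
basis of `ℤ[ζ]` over `ℤ[i]`, so everything is computed in the coordinates `Cyc`. Two relative norms
carry the geometry. Down to `ℤ[√3]`, `x * τ x` is `p - q √3`, with `p` half the sum of the squared
sides and `q` the oriented double area. Down to the Eisenstein integers, `γ x` records the
differences of squared sides. Both lead to the same absolute norm: `p² - 3q² = a² + ab + b²` for the
signature `(a, b)`. Multiplication by `ζ` permutes the sides, and multiplication by `1 + ζ`
subtracts all squared sides from a constant, which swaps `a` and `b`. As units are torsion times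
powers of `1 + ζ`, a coset is a double sequence.

Minimality comes from Heron's formula and the irrationality of `√3`. If a triangle is large compared
with its signature, an admissible competitor of no larger area has bounded signature and nearby `p`,
`|q|`. Both pairs solve Pell-type equations with small right-hand sides, so they coincide
(`pell_rigidity`, `isMin_iff_of_large`). Sliding is then impossible as well
(`not_sliding_of_large`).

Areas at two consecutive indices determine `p`, so compatibility means equal `p` and `|q|` at every
index (`IsCompatible.sim`), and families are the sets `Fam x`. A sequence never contains two
triangles with equal `p` and `|q|` but swapped unequal signature entries (`even_of_conj`). Hence,
for almost all `j`, the minimizing triangles for `D_j²` are all those with the given `p` and `|q|`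
(`IsCompatible.isMin_iff`). The class becomes the arithmetic condition `EltClass`, constant on a
family.

Examples are products of powers of `λ = 2 + i` and of a prime `π` over 13. Exchanging a factor with
its complex conjugate keeps the norm to `ℤ[√3]`. For `λ` it also keeps `γ`, hence the sides; for `π`
it changes `γ`. Suitable exponents give all four classes, with as many incongruent cosets as desired
in B0, B1, B2. -/

noncomputable section
namespace HardCore

/-! ### A coordinate model of `ℤ[ζ]` -/

/-- The element `m ζ¹⁰ + n ζ + k ζ² + l ζ⁵` of the 12-th cyclotomic ring, by its coordinates. -/
@[ext]
structure Cyc where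
  m : ℤ
  n : ℤ
  k : ℤ
  l : ℤ

namespace Cyc

instance : Zero Cyc := ⟨⟨0, 0, 0, 0⟩⟩
instance : One Cyc := ⟨⟨1, 0, 1, 0⟩⟩
instance : Add Cyc := ⟨fun x y => ⟨x.m + y.m, x.n + y.n, x.k + y.k, x.l + y.l⟩⟩
instance : Neg Cyc := ⟨fun x => ⟨-x.m, -x.n, -x.k, -x.l⟩⟩
-- The rule follows from `ζ¹⁰ + ζ² = 1` and `ζ¹⁰ ζ² = 1`, whence `(ζ¹⁰)² = -ζ²` and `(ζ²)² = -ζ¹⁰`.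
instance : Mul Cyc := ⟨fun x y =>
  ⟨(x.m * y.k - x.n * y.l) + (x.k * y.m - x.l * y.n) - (x.k * y.k - x.l * y.l),
   (x.m * y.l + x.n * y.k) + (x.k * y.n + x.l * y.m) - (x.k * y.l + x.l * y.k),
   (x.m * y.k - x.n * y.l) + (x.k * y.m - x.l * y.n) - (x.m * y.m - x.n * y.n),
   (x.m * y.l + x.n * y.k) + (x.k * y.n + x.l * y.m) - (x.m * y.n + x.n * y.m)⟩⟩

@[simp] lemma zero_m : (0 : Cyc).m = 0 := rfl
@[simp] lemma zero_n : (0 : Cyc).n = 0 := rfl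
@[simp] lemma zero_k : (0 : Cyc).k = 0 := rfl
@[simp] lemma zero_l : (0 : Cyc).l = 0 := rfl
@[simp] lemma one_m : (1 : Cyc).m = 1 := rfl
@[simp] lemma one_n : (1 : Cyc).n = 0 := rfl
@[simp] lemma one_k : (1 : Cyc).k = 1 := rfl
@[simp] lemma one_l : (1 : Cyc).l = 0 := rfl
@[simp] lemma add_m (x y : Cyc) : (x + y).m = x.m + y.m := rfl
@[simp] lemma add_n (x y : Cyc) : (x + y).n = x.n + y.n := rfl
@[simp] lemma add_k (x y : Cyc) : (x + y).k = x.k + y.k := rfl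
@[simp] lemma add_l (x y : Cyc) : (x + y).l = x.l + y.l := rfl
@[simp] lemma neg_m (x : Cyc) : (-x).m = -x.m := rfl
@[simp] lemma neg_n (x : Cyc) : (-x).n = -x.n := rfl
@[simp] lemma neg_k (x : Cyc) : (-x).k = -x.k := rfl
@[simp] lemma neg_l (x : Cyc) : (-x).l = -x.l := rfl
@[simp] lemma mul_m (x y : Cyc) : (x * y).m =
  (x.m * y.k - x.n * y.l) + (x.k * y.m - x.l * y.n) - (x.k * y.k - x.l * y.l) := rfl
@[simp] lemma mul_n (x y : Cyc) : (x * y).n =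
  (x.m * y.l + x.n * y.k) + (x.k * y.n + x.l * y.m) - (x.k * y.l + x.l * y.k) := rfl
@[simp] lemma mul_k (x y : Cyc) : (x * y).k =
  (x.m * y.k - x.n * y.l) + (x.k * y.m - x.l * y.n) - (x.m * y.m - x.n * y.n) := rfl
@[simp] lemma mul_l (x y : Cyc) : (x * y).l =
  (x.m * y.l + x.n * y.k) + (x.k * y.n + x.l * y.m) - (x.m * y.n + x.n * y.m) := rfl

instance : CommRing Cyc where
  add_assoc x y z := by ext <;> simp <;> ring
  zero_add x := by ext <;> simp
  add_zero x := by ext <;> simp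
  add_comm x y := by ext <;> simp <;> ring
  neg_add_cancel x := by ext <;> simp
  mul_assoc x y z := by ext <;> simp <;> ring
  one_mul x := by ext <;> simp
  mul_one x := by ext <;> simp
  mul_comm x y := by ext <;> simp <;> ring
  left_distrib x y z := by ext <;> simp <;> ring
  right_distrib x y z := by ext <;> simp <;> ring
  zero_mul x := by ext <;> simp
  mul_zero x := by ext <;> simp
  nsmul := nsmulRec
  zsmul := zsmulRec


/-- The root of unity `ζ`. -/
def Z : Cyc := ⟨0, 1, 0, 0⟩

/-- The fundamental unit `1 + ζ`. -/
def G : Cyc := ⟨1, 1, 1, 0⟩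

/-- The inverse of `1 + ζ`. -/
def Ginv : Cyc := ⟨0, -1, 1, -1⟩

@[simp] lemma Z_m : Z.m = 0 := rfl
@[simp] lemma Z_n : Z.n = 1 := rfl
@[simp] lemma Z_k : Z.k = 0 := rfl
@[simp] lemma Z_l : Z.l = 0 := rfl
@[simp] lemma G_m : G.m = 1 := rfl
@[simp] lemma G_n : G.n = 1 := rfl
@[simp] lemma G_k : G.k = 1 := rfl
@[simp] lemma G_l : G.l = 0 := rfl

lemma one_add_Z : 1 + Z = G := by ext <;> simp

lemma Z_pow_twelve : Z ^ 12 = 1 := by ext <;> simp [pow_succ]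

/-- `Z` as a unit. -/
def Zu : Cycˣ := ⟨Z, Z ^ 11, by rw [← pow_succ', Z_pow_twelve], by rw [← pow_succ, Z_pow_twelve]⟩

lemma Z_pow_inv (i : ℕ) : ∃ j : ℕ, Z ^ j * Z ^ i = 1 :=
  ⟨11 * i, by rw [← pow_add, show 11 * i + i = 12 * i by ring, pow_mul, Z_pow_twelve, one_pow]⟩

/-- `1 + ζ` as a unit. -/
def Gu : Cycˣ := ⟨G, Ginv, by ext <;> simp [Ginv], by ext <;> simp [Ginv]⟩

@[simp] lemma val_Gu : (Gu : Cyc) = G := rfl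
@[simp] lemma val_inv_Gu : ((Gu⁻¹ : Cycˣ) : Cyc) = Ginv := rfl

/-! ### Galois automorphisms -/

/-- The automorphism `ζ ↦ ζ⁵`, exchanging the two vertices. -/
def σ : Cyc →+* Cyc where
  toFun x := ⟨x.k, x.l, x.m, x.n⟩
  map_one' := rfl
  map_zero' := rfl
  map_mul' x y := by ext <;> simp <;> ring
  map_add' x y := rfl

/-- Complex conjugation. -/
def τ : Cyc →+* Cyc where
  toFun x := ⟨x.k, -x.l, x.m, -x.n⟩
  map_one' := rfl
  map_zero' := rfl
  map_mul' x y := by ext <;> simp <;> ring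
  map_add' x y := by ext <;> simp <;> ring

/-- The automorphism `ζ ↦ -ζ`. -/
def η : Cyc →+* Cyc where
  toFun x := ⟨x.m, -x.n, x.k, -x.l⟩
  map_one' := rfl
  map_zero' := rfl
  map_mul' x y := by ext <;> simp <;> ring
  map_add' x y := by ext <;> simp <;> ring

@[simp] lemma σ_m (x : Cyc) : (σ x).m = x.k := rfl
@[simp] lemma σ_n (x : Cyc) : (σ x).n = x.l := rfl
@[simp] lemma σ_k (x : Cyc) : (σ x).k = x.m := rfl
@[simp] lemma σ_l (x : Cyc) : (σ x).l = x.n := rfl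
@[simp] lemma τ_m (x : Cyc) : (τ x).m = x.k := rfl
@[simp] lemma τ_n (x : Cyc) : (τ x).n = -x.l := rfl
@[simp] lemma τ_k (x : Cyc) : (τ x).k = x.m := rfl
@[simp] lemma τ_l (x : Cyc) : (τ x).l = -x.n := rfl
@[simp] lemma η_m (x : Cyc) : (η x).m = x.m := rfl
@[simp] lemma η_n (x : Cyc) : (η x).n = -x.n := rfl
@[simp] lemma η_k (x : Cyc) : (η x).k = x.k := rfl
@[simp] lemma η_l (x : Cyc) : (η x).l = -x.l := rfl

@[simp] lemma σσ (x : Cyc) : σ (σ x) = x := rfl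
@[simp] lemma ττ (x : Cyc) : τ (τ x) = x := by ext <;> simp
@[simp] lemma ηη (x : Cyc) : η (η x) = x := by ext <;> simp
lemma στ (x : Cyc) : σ (τ x) = η x := rfl
lemma τσ (x : Cyc) : τ (σ x) = η x := rfl
lemma τη (x : Cyc) : τ (η x) = σ x := by ext <;> simp
lemma ητ (x : Cyc) : η (τ x) = σ x := by ext <;> simp
lemma ση (x : Cyc) : σ (η x) = τ x := rfl
lemma ησ (x : Cyc) : η (σ x) = τ x := rfl

lemma σ_Z : σ Z = Z ^ 5 := by ext <;> simp [pow_succ]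
lemma τ_Z : τ Z = Z ^ 11 := by ext <;> simp [pow_succ]
lemma η_Z : η Z = Z ^ 7 := by ext <;> simp [pow_succ]

/-! ### The quadratic forms -/

/-- Squared length of the first side. -/
def U (x : Cyc) : ℤ := x.m ^ 2 + x.n ^ 2
/-- Squared length of the second side. -/
def V (x : Cyc) : ℤ := x.k ^ 2 + x.l ^ 2
/-- Squared length of the third side. -/
def W (x : Cyc) : ℤ := (x.m - x.k) ^ 2 + (x.n - x.l) ^ 2
/-- Half of the sum of the squared side-lengths. -/
def p (x : Cyc) : ℤ := x.m ^ 2 + x.n ^ 2 + x.k ^ 2 + x.l ^ 2 - x.m * x.k - x.n * x.l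
/-- The oriented double area. -/
def q (x : Cyc) : ℤ := x.m * x.l - x.n * x.k

lemma U_nonneg (x : Cyc) : 0 ≤ U x := by unfold U; positivity
lemma V_nonneg (x : Cyc) : 0 ≤ V x := by unfold V; positivity
lemma W_nonneg (x : Cyc) : 0 ≤ W x := by unfold W; positivity

lemma two_p (x : Cyc) : 2 * p x = U x + V x + W x := by unfold p U V W; ring

lemma p_mul (x y : Cyc) : p (x * y) = p x * p y + 3 * (q x * q y) := by
  simp [p, q]; ring

lemma q_mul (x y : Cyc) : q (x * y) = p x * q y + q x * p y := by
  simp [p, q]; ring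

@[simp] lemma p_Z : p Z = 1 := by simp [p]
@[simp] lemma q_Z : q Z = 0 := by simp [q]
@[simp] lemma p_G : p G = 2 := by simp [p]
@[simp] lemma q_G : q G = -1 := by simp [q]
@[simp] lemma p_one : p 1 = 1 := by simp [p]
@[simp] lemma q_one : q 1 = 0 := by simp [q]
@[simp] lemma p_Ginv : p Ginv = 2 := by simp [p, Ginv]
@[simp] lemma q_Ginv : q Ginv = 1 := by simp [q, Ginv]

@[simp] lemma p_Z_pow (i : ℕ) : p (Z ^ i) = 1 ∧ q (Z ^ i) = 0 := by
  induction i with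
  | zero => simp
  | succ i ih => rw [pow_succ, p_mul, q_mul]; simp [ih]

@[simp] lemma p_Z_mul (i : ℕ) (x : Cyc) : p (Z ^ i * x) = p x := by simp [p_mul]
@[simp] lemma q_Z_mul (i : ℕ) (x : Cyc) : q (Z ^ i * x) = q x := by simp [q_mul]

@[simp] lemma p_σ (x : Cyc) : p (σ x) = p x := by simp [p]; ring
@[simp] lemma q_σ (x : Cyc) : q (σ x) = -q x := by simp [q]; ring
@[simp] lemma p_τ (x : Cyc) : p (τ x) = p x := by simp [p]; ring
@[simp] lemma q_τ (x : Cyc) : q (τ x) = q x := by simp [q]; ring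
@[simp] lemma p_η (x : Cyc) : p (η x) = p x := by simp [p]
@[simp] lemma q_η (x : Cyc) : q (η x) = -q x := by simp [q]; ring

lemma p_pos {x : Cyc} (hx : x ≠ 0) : 0 < p x := by
  by_contra h
  apply hx
  have h2 := two_p x
  have hU := U_nonneg x; have hV := V_nonneg x; have hW := W_nonneg x
  have hU0 : x.m ^ 2 + x.n ^ 2 = 0 := by change U x = 0; omega
  have hV0 : x.k ^ 2 + x.l ^ 2 = 0 := by change V x = 0; omega
  ext <;> simp <;> nlinarith

/-- The absolute norm, computed once through `ℚ(√3)` and once through the Eisenstein field; the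
second expression is visibly nonnegative. -/
lemma norm_eq (x : Cyc) : p x ^ 2 - 3 * q x ^ 2 =
    (U x - V x) ^ 2 + (U x - V x) * (V x - W x) + (V x - W x) ^ 2 := by
  unfold p q U V W; ring

lemma norm_nonneg (x : Cyc) : 0 ≤ p x ^ 2 - 3 * q x ^ 2 := by
  rw [norm_eq]; nlinarith [sq_nonneg (U x - V x + (V x - W x)), sq_nonneg (U x - V x), sq_nonneg (V x - W x)]

/-- This is `p x - q x * √3`, because `√3 = ζ - ζ⁵`. -/
lemma mul_τ (x : Cyc) : x * τ x = ⟨p x, -q x, p x, q x⟩ := by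
  ext <;> simp [p, q] <;> ring

lemma mul_τ_eq_iff {x y : Cyc} : x * τ x = y * τ y ↔ p x = p y ∧ q x = q y := by
  rw [mul_τ, mul_τ, Cyc.ext_iff]; simp; tauto

end Cyc

open Cyc

/-! ### The isomorphism with `ℤ[ζ]` -/

lemma zetaC_sq : zetaC ^ 2 = (1 + Complex.I * (Real.sqrt 3 : ℂ)) / 2 := by
  have h3 : ((Real.sqrt 3 : ℝ) : ℂ) ^ 2 = 3 := by
    rw [← Complex.ofReal_pow, Real.sq_sqrt (by norm_num)]; norm_num
  unfold zetaC
  linear_combination (1 / 4) * h3 + (1 / 4) * Complex.I_sq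

lemma zetaC_pow_four : zetaC ^ 4 = zetaC ^ 2 - 1 := by
  have h3 : ((Real.sqrt 3 : ℝ) : ℂ) ^ 2 = 3 := by
    rw [← Complex.ofReal_pow, Real.sq_sqrt (by norm_num)]; norm_num
  have : zetaC ^ 4 = (zetaC ^ 2) ^ 2 := by ring
  rw [this, zetaC_sq]
  linear_combination (1 / 4) * (Real.sqrt 3 : ℂ) ^ 2 * Complex.I_sq - (1 / 4) * h3

lemma zeta_pow_four : zeta ^ 4 = zeta ^ 2 - 1 := by
  apply Subtype.ext
  simpa [zeta] using zetaC_pow_four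

/-- The coordinate map onto `ℤ[ζ]`. -/
def toZZeta : Cyc →+* ZZeta where
  toFun x := (x.m : ZZeta) * zeta ^ 10 + (x.n : ZZeta) * zeta + (x.k : ZZeta) * zeta ^ 2 +
    (x.l : ZZeta) * zeta ^ 5
  map_zero' := by simp
  map_one' := by
    simp only [one_m, one_n, one_k, one_l]; push_cast
    linear_combination (zeta ^ 6 + zeta ^ 4 - 1) * zeta_pow_four
  map_add' x y := by simp; ring
  map_mul' x y := by
    have h : zeta ^ 4 = zeta ^ 2 - 1 := zeta_pow_four
    have h5 : zeta ^ 5 = zeta ^ 3 - zeta := by linear_combination zeta * h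
    have h10 : zeta ^ 10 = 1 - zeta ^ 2 := by
      linear_combination (zeta ^ 6 + zeta ^ 4 - 1) * h
    rw [h5, h10]
    simp only [mul_m, mul_n, mul_k, mul_l]; push_cast
    generalize zeta = z at *
    generalize (x.m : ZZeta) = a at *
    generalize (x.n : ZZeta) = b at *
    generalize (x.k : ZZeta) = c at *
    generalize (x.l : ZZeta) = d at *
    generalize (y.m : ZZeta) = a' at *
    generalize (y.n : ZZeta) = b' at *
    generalize (y.k : ZZeta) = c' at *
    generalize (y.l : ZZeta) = d' at *
    grind

lemma Cyc.mul_τ_real (x : Cyc) : ((toZZeta (x * τ x) : ZZeta) : ℂ) = (p x : ℂ) - q x * Real.sqrt 3 := by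
  have h : zetaC ^ 4 = zetaC ^ 2 - 1 := zetaC_pow_four
  have hI := Complex.I_sq
  have h3 : ((Real.sqrt 3 : ℝ) : ℂ) ^ 2 = 3 := by
    rw [← Complex.ofReal_pow, Real.sq_sqrt (by norm_num)]; norm_num
  have hs : zetaC ^ 3 - 2 * zetaC = -(Real.sqrt 3 : ℂ) := by
    have : zetaC ^ 3 = zetaC ^ 2 * zetaC := by ring
    rw [this, zetaC_sq, zetaC]
    linear_combination (1 / 4) * (Real.sqrt 3 : ℂ) * hI + (1 / 4) * Complex.I * h3
  rw [mul_τ]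
  simp only [toZZeta, RingHom.coe_mk, MonoidHom.coe_mk, OneHom.coe_mk, zeta]
  push_cast
  linear_combination ((p x : ℂ) * (zetaC ^ 6 + zetaC ^ 4 - 1) + q x * zetaC) * h + q x * hs

lemma eq_zero_of_sub_sqrt_three {a b : ℤ} (h : (a : ℝ) - b * Real.sqrt 3 = 0) : a = 0 ∧ b = 0 := by
  have hb : b = 0 := by
    by_contra hb
    have hb' : (b : ℝ) ≠ 0 := by exact_mod_cast hb
    refine (Nat.Prime.irrational_sqrt Nat.prime_three) ⟨(a : ℚ) / b, ?_⟩
    push_cast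
    rw [div_eq_iff hb']
    linarith
  subst hb
  simp at h
  exact ⟨h, rfl⟩

/-- A kernel element has `p - q √3 = 0`, so `p = 0` by irrationality of `√3`, and `p` is positive
definite. -/
lemma toZZeta_injective : Function.Injective toZZeta := by
  rw [injective_iff_map_eq_zero]
  intro x hx
  have h : ((toZZeta (x * τ x) : ZZeta) : ℂ) = 0 := by rw [map_mul, hx]; simp
  rw [mul_τ_real] at h
  by_contra hne
  exact (p_pos hne).ne' (eq_zero_of_sub_sqrt_three (by exact_mod_cast h)).1

lemma toZZeta_Z : toZZeta Z = zeta := by simp [toZZeta]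

lemma toZZeta_surjective : Function.Surjective toZZeta := by
  intro b
  have hle : ZZeta ≤ ((Subalgebra.val ZZeta).comp toZZeta.toIntAlgHom).range := by
    refine Algebra.adjoin_le ?_
    rintro _ rfl
    exact ⟨Z, by
      change ((toZZeta Z : ZZeta) : ℂ) = zetaC
      rw [toZZeta_Z]; rfl⟩
  obtain ⟨x, hx⟩ := hle b.2
  exact ⟨x, Subtype.ext hx⟩

/-- The coordinate model is isomorphic to `ℤ[ζ]`. -/
def cycEquiv : Cyc ≃+* ZZeta := RingEquiv.ofBijective toZZeta ⟨toZZeta_injective, toZZeta_surjective⟩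

@[simp] lemma cycEquiv_apply (x : Cyc) : cycEquiv x = toZZeta x := rfl

instance : IsDomain Cyc := Function.Injective.isDomain toZZeta toZZeta_injective

/-! ### Triangles and cosets in coordinates -/

/-- The coordinates of a triangle. -/
def E (T : Tri) : Cyc := ⟨(T 1 - T 0).1, (T 1 - T 0).2, (T 2 - T 0).1, (T 2 - T 0).2⟩

lemma toZZeta_E (T : Tri) : toZZeta (E T) = elt T := rfl

/-- The triangle with first vertex `(0,0)` and given coordinates. -/
def tri (x : Cyc) : Tri := ![(0, 0), (x.m, x.n), (x.k, x.l)]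

@[simp] lemma E_tri (x : Cyc) : E (tri x) = x := by simp [E, tri]

lemma elt_tri (x : Cyc) : elt (tri x) = toZZeta x := by rw [← toZZeta_E, E_tri]

lemma elt_eq_iff (T T' : Tri) (i : ℕ) : elt T' = zeta ^ i * elt T ↔ E T' = Z ^ i * E T := by
  rw [← toZZeta_E, ← toZZeta_E, ← toZZeta_Z, ← map_pow, ← map_mul, toZZeta_injective.eq_iff]

lemma elt_step_iff (T T' : Tri) (i : ℕ) :
    elt T' = zeta ^ i * (1 + zeta) * elt T ↔ E T' = Z ^ i * G * E T := by
  rw [← toZZeta_E, ← toZZeta_E, ← toZZeta_Z, ← map_pow, ← map_one toZZeta, ← map_add, ← map_mul,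
    ← map_mul, one_add_Z, toZZeta_injective.eq_iff]

theorem existsUnique_elt (β : ZZeta) :
    ∃! r : (ℤ × ℤ) × (ℤ × ℤ), elt ![(0, 0), r.1, r.2] = β := by
  obtain ⟨x, rfl⟩ := toZZeta_surjective β
  refine ⟨((x.m, x.n), (x.k, x.l)), elt_tri x, ?_⟩
  rintro ⟨⟨a, b⟩, ⟨c, d⟩⟩ h
  have := toZZeta_injective ((elt_tri ⟨a, b, c, d⟩).symm.trans h)
  subst this; rfl

/-- The coset of an element, in coordinates. -/
def cos (x : Cyc) : Coset := Associates.mk (toZZeta x)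

lemma coset_eq (T : Tri) : coset T = cos (E T) := rfl

lemma cos_surjective (c : Coset) : ∃ x, cos x = c := by
  obtain ⟨b, rfl⟩ := Associates.mk_surjective c
  obtain ⟨x, rfl⟩ := toZZeta_surjective b
  exact ⟨x, rfl⟩

lemma cos_eq_iff {x y : Cyc} : cos x = cos y ↔ Associated x y := by
  rw [cos, cos, Associates.mk_eq_mk_iff_associated]
  constructor
  · intro h
    simpa [← cycEquiv_apply] using h.map cycEquiv.symm
  · intro h
    exact h.map toZZeta

lemma cos_eq_zero_iff {x : Cyc} : cos x = 0 ↔ x = 0 := by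
  rw [cos, Associates.mk_eq_zero, map_eq_zero_iff _ toZZeta_injective]

/-! ### Units -/

namespace Cyc

lemma abs_le_one_of_sq_le {a : ℤ} (h : a ^ 2 ≤ 2) : a = -1 ∨ a = 0 ∨ a = 1 := by
  have h1 : -2 < a := by nlinarith
  have h2 : a < 2 := by nlinarith
  omega

instance : DecidableEq Cyc := fun x y =>
  decidable_of_iff (x.m = y.m ∧ x.n = y.n ∧ x.k = y.k ∧ x.l = y.l) Cyc.ext_iff.symm

lemma eq_Z_pow {x : Cyc} (hp : p x = 1) (hq : q x = 0) : ∃ i : ℕ, x = Z ^ i := by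
  obtain ⟨m, n, k, l⟩ := x
  have h := two_p ⟨m, n, k, l⟩
  rw [hp] at h
  have hm : m ^ 2 ≤ 2 := by simp only [U, V, W] at h; nlinarith
  have hn : n ^ 2 ≤ 2 := by simp only [U, V, W] at h; nlinarith
  have hk : k ^ 2 ≤ 2 := by simp only [U, V, W] at h; nlinarith
  have hl : l ^ 2 ≤ 2 := by simp only [U, V, W] at h; nlinarith
  -- The squared sides add up to `2 p = 2`, which leaves only coordinates `-1, 0, 1`: a finite
  -- check.
  have key : ∀ m ∈ ({-1, 0, 1} : Finset ℤ), ∀ n ∈ ({-1, 0, 1} : Finset ℤ),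
      ∀ k ∈ ({-1, 0, 1} : Finset ℤ), ∀ l ∈ ({-1, 0, 1} : Finset ℤ),
      m ^ 2 + n ^ 2 + k ^ 2 + l ^ 2 - m * k - n * l = 1 → m * l - n * k = 0 →
      ∃ i ∈ Finset.range 12, (⟨m, n, k, l⟩ : Cyc) = Z ^ i := by
    decide
  obtain ⟨i, -, h⟩ := key m (by simpa using abs_le_one_of_sq_le hm)
    n (by simpa using abs_le_one_of_sq_le hn) k (by simpa using abs_le_one_of_sq_le hk)
    l (by simpa using abs_le_one_of_sq_le hl) hp hq
  exact ⟨i, h⟩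

lemma norm_unit (u : Cycˣ) : p (u : Cyc) ^ 2 - 3 * q (u : Cyc) ^ 2 = 1 := by
  have h1 := norm_nonneg (u : Cyc)
  have h2 := norm_nonneg ((u⁻¹ : Cycˣ) : Cyc)
  have hp := p_mul (u : Cyc) ((u⁻¹ : Cycˣ) : Cyc)
  have hq := q_mul (u : Cyc) ((u⁻¹ : Cycˣ) : Cyc)
  rw [Units.mul_inv] at hp hq
  simp only [p_one, q_one] at hp hq
  have h : (p (u : Cyc) ^ 2 - 3 * q (u : Cyc) ^ 2) *
      (p ((u⁻¹ : Cycˣ) : Cyc) ^ 2 - 3 * q ((u⁻¹ : Cycˣ) : Cyc) ^ 2) = 1 := by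
    linear_combination (-(p (u : Cyc) * p ((u⁻¹ : Cycˣ) : Cyc) + 3 * (q (u : Cyc) * q ((u⁻¹ : Cycˣ) : Cyc))) - 1) * hp
      + 3 * (p (u : Cyc) * q ((u⁻¹ : Cycˣ) : Cyc) + q (u : Cyc) * p ((u⁻¹ : Cycˣ) : Cyc)) * hq
  rcases Int.mul_eq_one_iff_eq_one_or_neg_one.mp h with h | h
  · exact h.1
  · omega

/-- Descent on `|q|`. Since `p² = 3q² + 1`, a positive `q` satisfies `q < p < 3q`, and
multiplication by `1 + ζ` replaces it by `2q - p`, which is smaller in absolute value. Negative `q`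
uses the inverse, and `q = 0` is torsion. -/
theorem exists_eq_Z_pow_mul_G_zpow (u : Cycˣ) : ∃ (i : ℕ) (k : ℤ), (u : Cyc) = Z ^ i * ((Gu ^ k : Cycˣ) : Cyc) := by
  induction hn : (q (u : Cyc)).natAbs using Nat.strong_induction_on generalizing u with
  | _ n ih =>
    have hN := norm_unit u
    have hp := p_pos u.ne_zero
    rcases lt_trichotomy (q (u : Cyc)) 0 with hq | hq | hq
    · have hlt : (q ((u * Gu⁻¹ : Cycˣ) : Cyc)).natAbs < n := by
        rw [Units.val_mul, q_mul, val_inv_Gu, p_Ginv, q_Ginv]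
        have h1 : -q (u : Cyc) < p (u : Cyc) := by nlinarith
        have h2 : p (u : Cyc) < -3 * q (u : Cyc) := by nlinarith
        omega
      obtain ⟨i, k, h⟩ := ih _ hlt _ rfl
      refine ⟨i, k + 1, ?_⟩
      rw [zpow_add_one, Units.val_mul, ← mul_assoc, ← h, ← Units.val_mul, inv_mul_cancel_right]
    · obtain ⟨i, hi⟩ := eq_Z_pow (x := u) (by rw [hq] at hN; nlinarith) hq
      exact ⟨i, 0, by simpa using hi⟩
    · have hlt : (q ((u * Gu : Cycˣ) : Cyc)).natAbs < n := by
        rw [Units.val_mul, q_mul, val_Gu, p_G, q_G]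
        have h1 : q (u : Cyc) < p (u : Cyc) := by nlinarith
        have h2 : p (u : Cyc) < 3 * q (u : Cyc) := by nlinarith
        omega
      obtain ⟨i, k, h⟩ := ih _ hlt _ rfl
      refine ⟨i, k - 1, ?_⟩
      rw [zpow_sub_one, Units.val_mul, ← mul_assoc, ← h, ← Units.val_mul, mul_inv_cancel_right]

lemma associated_iff {x y : Cyc} :
    Associated x y ↔ ∃ (i : ℕ) (k : ℤ), y = Z ^ i * (((Gu ^ k : Cycˣ) : Cyc) * x) := by
  constructor
  · rintro ⟨u, rfl⟩
    obtain ⟨i, k, h⟩ := exists_eq_Z_pow_mul_G_zpow u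
    exact ⟨i, k, by rw [h]; ring⟩
  · rintro ⟨i, k, rfl⟩
    exact ⟨Zu ^ i * Gu ^ k, by push_cast; change x * (Z ^ i * _) = _; ring⟩

end Cyc

/-! ### Congruence -/

/-- Congruence in coordinates: up to torsion units, equality up to a Galois automorphism. -/
def Cong (x y : Cyc) : Prop :=
  ∃ i : ℕ, y = Z ^ i * x ∨ y = Z ^ i * τ x ∨ y = Z ^ i * σ x ∨ y = Z ^ i * η x

lemma Cong.trans {x y z : Cyc} (h : Cong x y) (h' : Cong y z) : Cong x z := by
  obtain ⟨i, h⟩ := h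
  obtain ⟨j, h'⟩ := h'
  rcases h' with h' | h' | h' | h' <;> rw [h']
  · refine ⟨j + i, ?_⟩
    simp only [pow_add, mul_assoc]
    rcases h with h | h | h | h <;> simp [h]
  · refine ⟨j + 11 * i, ?_⟩
    simp only [pow_add, mul_assoc, pow_mul, ← τ_Z, ← map_pow]
    rcases h with h | h | h | h <;> simp [h, τσ, τη]
  · refine ⟨j + 5 * i, ?_⟩
    simp only [pow_add, mul_assoc, pow_mul, ← σ_Z, ← map_pow]
    rcases h with h | h | h | h <;> simp [h, στ, ση]
  · refine ⟨j + 7 * i, ?_⟩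
    simp only [pow_add, mul_assoc, pow_mul, ← η_Z, ← map_pow]
    rcases h with h | h | h | h <;> simp [h, ητ, ησ]

lemma latticeSym_comp (s t s' t' : ℤˣ) (w w' : Bool) (c c' : ℤ × ℤ) :
    ∃ (s₁ t₁ : ℤˣ) (w₁ : Bool) (c₁ : ℤ × ℤ), ∀ r,
      latticeSym s' t' w' c' (latticeSym s t w c r) = latticeSym s₁ t₁ w₁ c₁ r := by
  cases w <;> cases w'
  · exact ⟨s' * s, t' * t, false, (c'.1 + s' * c.1, c'.2 + t' * c.2), fun r => by
      ext <;> simp [latticeSym] <;> ring⟩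
  · exact ⟨s' * t, t' * s, true, (c'.1 + s' * c.2, c'.2 + t' * c.1), fun r => by
      ext <;> simp [latticeSym] <;> ring⟩
  · exact ⟨s' * s, t' * t, true, (c'.1 + s' * c.1, c'.2 + t' * c.2), fun r => by
      ext <;> simp [latticeSym] <;> ring⟩
  · exact ⟨s' * t, t' * s, false, (c'.1 + s' * c.2, c'.2 + t' * c.1), fun r => by
      ext <;> simp [latticeSym] <;> ring⟩

lemma Z2Congruent.trans {T T' T'' : Tri} (h : Z2Congruent T T') (h' : Z2Congruent T' T'') :
    Z2Congruent T T'' := by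
  obtain ⟨s, t, w, c, π, h⟩ := h
  obtain ⟨s', t', w', c', π', h'⟩ := h'
  obtain ⟨s₁, t₁, w₁, c₁, h₁⟩ := latticeSym_comp s t s' t' w w' c c'
  exact ⟨s₁, t₁, w₁, c₁, π * π', fun i => by rw [h', h, h₁]; rfl⟩

lemma perm_three (π : Equiv.Perm (Fin 3)) :
    (π 0 = 0 ∧ π 1 = 1 ∧ π 2 = 2) ∨ (π 0 = 0 ∧ π 1 = 2 ∧ π 2 = 1) ∨
    (π 0 = 1 ∧ π 1 = 0 ∧ π 2 = 2) ∨ (π 0 = 1 ∧ π 1 = 2 ∧ π 2 = 0) ∨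
    (π 0 = 2 ∧ π 1 = 0 ∧ π 2 = 1) ∨ (π 0 = 2 ∧ π 1 = 1 ∧ π 2 = 0) := by
  revert π; decide

/-- Cyclic relabelling is multiplication by `ζ⁴` or `ζ⁸`; exchanging the vertices 1 and 2 is `σ`. -/
lemma cong_perm (T : Tri) (π : Equiv.Perm (Fin 3)) : Cong (E T) (E (T ∘ π)) := by
  rcases perm_three π with ⟨h0, h1, h2⟩ | ⟨h0, h1, h2⟩ | ⟨h0, h1, h2⟩ | ⟨h0, h1, h2⟩ |
    ⟨h0, h1, h2⟩ | ⟨h0, h1, h2⟩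
  · exact ⟨0, Or.inl (by ext <;> simp [E, h0, h1, h2])⟩
  · exact ⟨0, Or.inr (Or.inr (Or.inl (by ext <;> simp [E, h0, h1, h2])))⟩
  · exact ⟨4, Or.inr (Or.inr (Or.inl (by ext <;> simp [E, h0, h1, h2, pow_succ])))⟩
  · exact ⟨8, Or.inl (by ext <;> simp [E, h0, h1, h2, pow_succ])⟩
  · exact ⟨4, Or.inl (by ext <;> simp [E, h0, h1, h2, pow_succ])⟩
  · exact ⟨8, Or.inr (Or.inr (Or.inl (by ext <;> simp [E, h0, h1, h2, pow_succ])))⟩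

/-- Quarter turns are powers of `ζ³ = i`, and the reflection in the first axis is `η`. -/
lemma cong_latticeSym (T : Tri) (s t : ℤˣ) (w : Bool) (c : ℤ × ℤ) :
    Cong (E T) (E (fun i => latticeSym s t w c (T i))) := by
  rcases Int.units_eq_one_or s with rfl | rfl <;> rcases Int.units_eq_one_or t with rfl | rfl <;>
    cases w
  · exact ⟨0, Or.inl (by ext <;> simp [E, latticeSym])⟩
  · exact ⟨3, Or.inr (Or.inr (Or.inr (by ext <;> simp [E, latticeSym, pow_succ])))⟩
  · exact ⟨0, Or.inr (Or.inr (Or.inr (by ext <;> simp [E, latticeSym] <;> ring)))⟩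
  · exact ⟨9, Or.inl (by ext <;> simp [E, latticeSym, pow_succ] <;> ring)⟩
  · exact ⟨6, Or.inr (Or.inr (Or.inr (by ext <;> simp [E, latticeSym, pow_succ] <;> ring)))⟩
  · exact ⟨3, Or.inl (by ext <;> simp [E, latticeSym, pow_succ] <;> ring)⟩
  · exact ⟨6, Or.inl (by ext <;> simp [E, latticeSym, pow_succ] <;> ring)⟩
  · exact ⟨9, Or.inr (Or.inr (Or.inr (by ext <;> simp [E, latticeSym, pow_succ] <;> ring)))⟩

lemma z2_of_eq {T T' : Tri} (h : E T' = E T) : Z2Congruent T T' := by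
  rw [Cyc.ext_iff] at h
  simp [E] at h
  refine ⟨1, 1, false, T' 0 - T 0, 1, fun i => ?_⟩
  fin_cases i <;> ext <;> simp [latticeSym] <;> omega

lemma z2_of_Z {T T' : Tri} (h : E T' = Z * E T) : Z2Congruent T T' := by
  rw [Cyc.ext_iff] at h
  simp [E] at h
  -- `ζ = ζ⁻³ ζ⁴` is a clockwise quarter turn with a cyclic relabelling; the relabelling puts vertex
  -- 2 first, so the shift is read off there.
  refine ⟨1, -1, true, T' 0 - ((T 2).2, -(T 2).1), finRotate 3 * finRotate 3, fun i => ?_⟩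
  fin_cases i <;> ext <;> simp [latticeSym] <;> omega

lemma z2_of_σ {T T' : Tri} (h : E T' = σ (E T)) : Z2Congruent T T' := by
  rw [Cyc.ext_iff] at h
  simp [E] at h
  refine ⟨1, 1, false, T' 0 - T 0, Equiv.swap 1 2, fun i => ?_⟩
  fin_cases i <;> ext <;> simp [latticeSym, Equiv.swap_apply_def] <;> omega

lemma z2_of_η {T T' : Tri} (h : E T' = η (E T)) : Z2Congruent T T' := by
  rw [Cyc.ext_iff] at h
  simp [E] at h
  refine ⟨1, -1, false, T' 0 - ((T 0).1, -(T 0).2), 1, fun i => ?_⟩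
  fin_cases i <;> ext <;> simp [latticeSym] <;> omega

lemma z2_of_Z_pow (i : ℕ) : ∀ {T T' : Tri}, E T' = Z ^ i * E T → Z2Congruent T T' := by
  induction i with
  | zero => intro T T' h; exact z2_of_eq (by simpa using h)
  | succ i ih =>
    intro T T' h
    refine (ih (T' := tri (Z ^ i * E T)) (by simp)).trans (z2_of_Z ?_)
    rw [h, E_tri]; ring

theorem z2Congruent_iff {T T' : Tri} : Z2Congruent T T' ↔ Cong (E T) (E T') := by
  constructor
  · rintro ⟨s, t, w, c, π, h⟩
    refine (cong_perm T π).trans ?_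
    have : T' = fun i => latticeSym s t w c ((T ∘ π) i) := funext h
    rw [this]
    exact cong_latticeSym _ s t w c
  · rintro ⟨i, h | h | h | h⟩
    · exact z2_of_Z_pow i h
    · refine ((z2_of_η (T' := tri (η (E T))) (by simp)).trans
        (z2_of_σ (T' := tri (τ (E T))) (by simp [ση]))).trans (z2_of_Z_pow i ?_)
      simpa using h
    · exact (z2_of_σ (T' := tri (σ (E T))) (by simp)).trans (z2_of_Z_pow i (by simpa using h))
    · exact (z2_of_η (T' := tri (η (E T))) (by simp)).trans (z2_of_Z_pow i (by simpa using h))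

namespace Cyc

/-! ### Ordered side-lengths -/

/-- The shortest squared side. -/
def lo (x : Cyc) : ℤ := min (W x) (min (V x) (U x))
/-- The middle squared side. -/
def mid (x : Cyc) : ℤ := max (min (W x) (V x)) (min (max (W x) (V x)) (U x))
/-- The longest squared side. -/
def hi (x : Cyc) : ℤ := max (W x) (max (V x) (U x))

lemma lo_le_mid (x : Cyc) : lo x ≤ mid x := by unfold lo mid; omega
lemma mid_le_hi (x : Cyc) : mid x ≤ hi x := by unfold hi mid; omega
lemma lo_add (x : Cyc) : lo x + mid x + hi x = 2 * p x := by
  rw [two_p]; unfold lo mid hi; omega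

/-- The signature. -/
def sg (x : Cyc) : ℤ × ℤ := (mid x - lo x, hi x - mid x)

lemma lo_eq (x : Cyc) : 3 * lo x = 2 * p x - 2 * (sg x).1 - (sg x).2 := by
  have := lo_add x; simp only [sg]; omega

lemma sides_eq_of_sg {x y : Cyc} (hp : p x = p y) (h : sg x = sg y) :
    lo x = lo y ∧ mid x = mid y ∧ hi x = hi y := by
  have := lo_add x; have := lo_add y
  simp only [sg, Prod.mk.injEq] at h; omega

lemma U_Z (x : Cyc) : U (Z * x) = V x := by simp [U, V]; ring
lemma V_Z (x : Cyc) : V (Z * x) = W x := by simp [W, V]; ring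
lemma W_Z (x : Cyc) : W (Z * x) = U x := by simp [U, W]; ring
lemma U_G (x : Cyc) : U (G * x) = 2 * p x - 2 * q x - W x := by simp [U, W, p, q]; ring
lemma V_G (x : Cyc) : V (G * x) = 2 * p x - 2 * q x - U x := by simp [U, V, p, q]; ring
lemma W_G (x : Cyc) : W (G * x) = 2 * p x - 2 * q x - V x := by simp [V, W, p, q]; ring

lemma lo_Z (x : Cyc) : lo (Z * x) = lo x := by simp only [lo, U_Z, V_Z, W_Z]; omega
lemma mid_Z (x : Cyc) : mid (Z * x) = mid x := by simp only [mid, U_Z, V_Z, W_Z]; omega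
lemma hi_Z (x : Cyc) : hi (Z * x) = hi x := by simp only [hi, U_Z, V_Z, W_Z]; omega

lemma sides_Z_pow (i : ℕ) (x : Cyc) :
    lo (Z ^ i * x) = lo x ∧ mid (Z ^ i * x) = mid x ∧ hi (Z ^ i * x) = hi x := by
  induction i with
  | zero => simp
  | succ i ih => rw [pow_succ', mul_assoc, lo_Z, mid_Z, hi_Z]; exact ih

lemma sides_σ (x : Cyc) : lo (σ x) = lo x ∧ mid (σ x) = mid x ∧ hi (σ x) = hi x := by
  have hU : U (σ x) = V x := by simp [U, V]
  have hV : V (σ x) = U x := by simp [U, V]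
  have hW : W (σ x) = W x := by simp [W]; ring
  simp only [lo, mid, hi, hU, hV, hW]; omega

lemma sides_η (x : Cyc) : lo (η x) = lo x ∧ mid (η x) = mid x ∧ hi (η x) = hi x := by
  have hU : U (η x) = U x := by simp [U]
  have hV : V (η x) = V x := by simp [V]
  have hW : W (η x) = W x := by simp [W]; ring
  simp only [lo, mid, hi, hU, hV, hW, and_self]

lemma sides_τ (x : Cyc) : lo (τ x) = lo x ∧ mid (τ x) = mid x ∧ hi (τ x) = hi x := by
  rw [← ση]
  have h1 := sides_σ (η x); have h2 := sides_η x; omega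

@[simp] lemma sg_Z_pow (i : ℕ) (x : Cyc) : sg (Z ^ i * x) = sg x := by
  obtain ⟨h1, h2, h3⟩ := sides_Z_pow i x
  simp [sg, h1, h2, h3]

@[simp] lemma sg_σ (x : Cyc) : sg (σ x) = sg x := by
  obtain ⟨h1, h2, h3⟩ := sides_σ x
  simp [sg, h1, h2, h3]

/-- Each new squared side is `2 (p - q)` minus an old one, so the order of the sides is reversed and
the two gaps change places. -/
lemma sg_G (x : Cyc) : sg (G * x) = (sg x).swap := by
  simp only [sg, lo, mid, hi, U_G, V_G, W_G, Prod.swap, Prod.mk.injEq]; omega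

/-! ### The sequence `(1 + ζ)ᵏ x` -/

/-- The `k`-th member of the double sequence through `x`. -/
def g (k : ℤ) (x : Cyc) : Cyc := ((Gu ^ k : Cycˣ) : Cyc) * x

@[simp] lemma g_zero (x : Cyc) : g 0 x = x := by simp [g]
lemma g_add (k l : ℤ) (x : Cyc) : g (k + l) x = g k (g l x) := by
  simp [g, zpow_add, mul_assoc]
lemma g_one (x : Cyc) : g 1 x = G * x := by simp [g]
lemma g_succ (k : ℤ) (x : Cyc) : g (k + 1) x = G * g k x := by
  rw [add_comm, g_add, g_one]
lemma g_mul (k : ℤ) (x y : Cyc) : g k (x * y) = x * g k y := by unfold g; ring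

lemma g_ne_zero (k : ℤ) {x : Cyc} (hx : x ≠ 0) : g k x ≠ 0 :=
  mul_ne_zero (Units.ne_zero _) hx

lemma sg_g (k : ℤ) (x : Cyc) : sg (g k x) = if Even k then sg x else (sg x).swap := by
  have hs : ∀ k, sg (g (k + 1) x) = (sg (g k x)).swap := fun k => by rw [g_succ, sg_G]
  induction k using Int.induction_on with
  | zero => simp
  | succ i ih =>
    rw [hs, ih]
    by_cases h : Even (i : ℤ)
    · rw [if_pos h, if_neg (by rwa [Int.even_add_one, not_not])]
    · rw [if_neg h, if_pos (by rwa [Int.even_add_one]), Prod.swap_swap]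
  | pred i ih =>
    have := hs (-(i : ℤ) - 1)
    rw [sub_add_cancel, ih] at this
    rw [← Prod.swap_swap (sg (g (-(i : ℤ) - 1) x)), ← this]
    by_cases h : Even (-(i : ℤ))
    · rw [if_pos h, if_neg (by rwa [Int.even_sub_one, not_not])]
    · rw [if_neg h, if_pos (by rwa [Int.even_sub_one]), Prod.swap_swap]

lemma abs_q_lt {x : Cyc} (hx : x ≠ 0) : |q x| < p x := by
  have h1 := norm_nonneg x
  have h2 := p_pos hx
  apply abs_lt_of_sq_lt_sq _ h2.le
  by_contra h
  nlinarith

lemma p_G_mul (x : Cyc) : p (G * x) = 2 * p x - 3 * q x := by rw [p_mul]; simp; ring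
lemma q_G_mul (x : Cyc) : q (G * x) = 2 * q x - p x := by rw [q_mul]; simp; ring

/-- A step sends `q` to `2q - p`, and `q < p`. Since torsion does not change `q`, its value
identifies the position in the sequence. -/
lemma q_g_strictAnti {x : Cyc} (hx : x ≠ 0) : StrictAnti fun k => q (g k x) := by
  apply strictAnti_int_of_succ_lt
  intro k
  rw [g_succ, q_G_mul]
  have := (abs_lt.mp (abs_q_lt (g_ne_zero k hx))).2
  linarith

lemma norm_g (k : ℤ) (x : Cyc) : p (g k x) ^ 2 - 3 * q (g k x) ^ 2 = p x ^ 2 - 3 * q x ^ 2 := by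
  have h := norm_unit (Gu ^ k)
  rw [g, p_mul, q_mul]
  linear_combination (p x ^ 2 - 3 * q x ^ 2) * h

lemma finite_abs_q_g_le {x : Cyc} (hx : x ≠ 0) (C : ℤ) : {k : ℤ | |q (g k x)| ≤ C}.Finite := by
  refine ((Set.finite_Icc (-C) C).preimage (q_g_strictAnti hx).injective.injOn).subset ?_
  intro k hk
  exact abs_le.mp hk

lemma finite_p_g_le {x : Cyc} (hx : x ≠ 0) (C : ℤ) : {k : ℤ | p (g k x) ≤ C}.Finite :=
  (finite_abs_q_g_le hx C).subset fun k hk =>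
    ((abs_q_lt (g_ne_zero k hx)).le.trans hk : |q (g k x)| ≤ C)

/-- From `q (2q - p) ≤ 0` one gets `4q² ≤ p²` or `q = 0`, so `q²` is at most the norm `p² - 3q²`, a
constant of the sequence. -/
lemma finite_q_mul_q_nonpos {x : Cyc} (hx : x ≠ 0) :
    {k : ℤ | q (g k x) * q (g (k + 1) x) ≤ 0}.Finite := by
  refine (finite_abs_q_g_le hx (p x ^ 2 - 3 * q x ^ 2)).subset fun k hk => ?_
  change |q (g k x)| ≤ _
  change q (g k x) * q (g (k + 1) x) ≤ 0 at hk
  rw [g_succ, q_G_mul] at hk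
  have hN := norm_g k x
  have hN0 := norm_nonneg x
  set P := p (g k x); set Q := q (g k x)
  rw [← hN] at hN0 ⊢
  have h1 : Q ^ 2 ≤ P ^ 2 - 3 * Q ^ 2 := by
    by_contra h
    have hQ : 0 < Q ^ 2 := by nlinarith
    have h2 : (2 * Q ^ 2) ^ 2 ≤ (P * Q) ^ 2 := by
      apply pow_le_pow_left₀ (by positivity); nlinarith
    nlinarith
  calc |Q| ≤ |Q| ^ 2 := by
        rcases eq_or_ne Q 0 with h | h
        · simp [h]
        · have := abs_pos.mpr h; nlinarith
    _ = Q ^ 2 := sq_abs Q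
    _ ≤ _ := h1

lemma finite_comp_neg {P : ℤ → Prop} (h : {k | P k}.Finite) : {k | P (-k)}.Finite :=
  h.preimage (neg_injective.injOn)

/-- Two members of the sequence through `x` that differ by a torsion unit coincide. -/
lemma g_eq_index {x : Cyc} (hx : x ≠ 0) {k l : ℤ} (h : q (g k x) = q (g l x)) : k = l :=
  (q_g_strictAnti hx).injective h

end Cyc

/-! ### Triangles -/

lemma sqDist_cast (a b : ℤ × ℤ) : (sqDist a b : ℤ) = (a.1 - b.1) ^ 2 + (a.2 - b.2) ^ 2 := by
  simp [sqDist]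

lemma sideSq_zero (T : Tri) : (sideSq T 0 : ℤ) = W (E T) := by
  simp only [sideSq, sqDist_cast, W, E]; simp

lemma sideSq_one (T : Tri) : (sideSq T 1 : ℤ) = V (E T) := by
  simp only [sideSq, sqDist_cast, V, E]; simp

lemma sideSq_two (T : Tri) : (sideSq T 2 : ℤ) = U (E T) := by
  have h : sideSq T 2 = sqDist (T 0) (T 1) := rfl
  simp only [h, sqDist_cast, U, E]; simp; ring

lemma shortSq_cast (T : Tri) : (shortSq T : ℤ) = lo (E T) := by
  simp [shortSq, lo, sideSq_zero, sideSq_one, sideSq_two]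
lemma midSq_cast (T : Tri) : (midSq T : ℤ) = mid (E T) := by
  simp [midSq, mid, sideSq_zero, sideSq_one, sideSq_two]
lemma longSq_cast (T : Tri) : (longSq T : ℤ) = hi (E T) := by
  simp [longSq, hi, sideSq_zero, sideSq_one, sideSq_two]

lemma signature_eq (T : Tri) : signature T = sg (E T) := by
  simp [signature, sg, shortSq_cast, midSq_cast, longSq_cast]

lemma dblArea_cast (T : Tri) : (dblArea T : ℤ) = |q (E T)| := by
  simp [dblArea, cross, q, E]

lemma dblArea_eq_iff (T T' : Tri) : dblArea T = dblArea T' ↔ |q (E T)| = |q (E T')| := by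
  rw [← dblArea_cast, ← dblArea_cast, Nat.cast_inj]

lemma sideType_eq_iff (T T' : Tri) : sideType T = sideType T' ↔
    lo (E T) = lo (E T') ∧ mid (E T) = mid (E T') ∧ hi (E T) = hi (E T') := by
  simp only [← shortSq_cast, ← midSq_cast, ← longSq_cast, Nat.cast_inj, sideType, Prod.mk.injEq]

lemma admissible_iff (d : ℕ) (T : Tri) :
    Admissible d T ↔ (d : ℤ) ≤ lo (E T) ∧ hi (E T) ≤ mid (E T) + lo (E T) := by
  have h0 := sideSq_zero T; have h1 := sideSq_one T; have h2 := sideSq_two T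
  unfold Admissible
  simp only [Fin.forall_fin_succ, IsEmpty.forall_iff, and_true]
  have e1 : (Fin.succ 0 : Fin 3) = 1 := rfl
  have e2 : (Fin.succ (Fin.succ 0) : Fin 3) = 2 := rfl
  have e3 : (0 + 1 : Fin 3) = 1 := rfl
  have e4 : (0 + 2 : Fin 3) = 2 := rfl
  have e5 : (1 + 1 : Fin 3) = 2 := rfl
  have e6 : (1 + 2 : Fin 3) = 0 := rfl
  have e7 : (2 + 1 : Fin 3) = 0 := rfl
  have e8 : (2 + 2 : Fin 3) = 1 := rfl
  simp only [e1, e2, e3, e4, e5, e6, e7, e8]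
  unfold lo hi mid
  omega

lemma Cong.invariants {x y : Cyc} (h : Cong x y) :
    lo y = lo x ∧ mid y = mid x ∧ hi y = hi x ∧ p y = p x ∧ |q y| = |q x| := by
  obtain ⟨i, h | h | h | h⟩ := h <;> subst h <;> simp only [p_Z_mul, q_Z_mul, p_τ, q_τ, p_σ, q_σ,
    p_η, q_η, abs_neg, and_true]
  · exact sides_Z_pow i x
  · have h1 := sides_Z_pow i (τ x); have h2 := sides_τ x; omega
  · have h1 := sides_Z_pow i (σ x); have h2 := sides_σ x; omega
  · have h1 := sides_Z_pow i (η x); have h2 := sides_η x; omega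

/-! ### Indexations -/

lemma cos_g (k : ℤ) (i : ℕ) (x : Cyc) : cos (Z ^ i * g k x) = cos x :=
  (cos_eq_iff.mpr (associated_iff.mpr ⟨i, k, rfl⟩)).symm

lemma isIndexation_tri (x : Cyc) (δ : ℤ) (hδ : δ = 1 ∨ δ = -1) :
    IsIndexation (cos x) fun j => tri (g (δ * j) x) := by
  refine ⟨fun j => ?_, ?_⟩
  · rw [coset_eq, E_tri]
    simpa using cos_g (δ * j) 0 x
  · rcases hδ with rfl | rfl
    · refine Or.inl fun j => ⟨0, ?_⟩
      rw [elt_step_iff]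
      simp [g_succ]
    · refine Or.inr fun j => ⟨0, ?_⟩
      rw [elt_step_iff]
      simp only [E_tri, pow_zero, one_mul, ← g_succ]
      congr 1; ring

/-- Merges the two directions allowed in an indexation into a sign `δ`, so that later arguments
treat them together. -/
lemma IsIndexation.exists_eq {c : Coset} {X : ℤ → Tri} (h : IsIndexation c X) :
    ∃ δ : ℤ, (δ = 1 ∨ δ = -1) ∧ ∀ j, ∃ i : ℕ, E (X j) = Z ^ i * g (δ * j) (E (X 0)) := by
  rcases h.2 with h | h
  · refine ⟨1, Or.inl rfl, fun j => ?_⟩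
    simp only [elt_step_iff] at h
    induction j using Int.induction_on with
    | zero => exact ⟨0, by simp⟩
    | succ j ih =>
      obtain ⟨i, hi⟩ := ih
      obtain ⟨i', hi'⟩ := h j
      refine ⟨i' + i, ?_⟩
      rw [hi', hi, one_mul, one_mul, g_succ]; ring
    | pred j ih =>
      obtain ⟨i, hi⟩ := ih
      obtain ⟨i', hi'⟩ := h (-(j : ℤ) - 1)
      obtain ⟨i'', hi''⟩ := Z_pow_inv i'
      refine ⟨i'' + i, ?_⟩
      have he : g (1 * -(j : ℤ)) (E (X 0)) = G * g (-(j : ℤ) - 1) (E (X 0)) := by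
        rw [← g_succ]; congr 1; ring
      rw [sub_add_cancel, hi, he] at hi'
      rw [one_mul]
      apply mul_left_cancel₀ (Units.ne_zero Gu)
      rw [val_Gu]
      calc G * E (X (-(j : ℤ) - 1)) = (Z ^ i'' * Z ^ i') * (G * E (X (-(j : ℤ) - 1))) := by
            rw [hi'', one_mul]
        _ = Z ^ i'' * (Z ^ i' * G * E (X (-(j : ℤ) - 1))) := by ring
        _ = _ := by rw [← hi']; ring
  · refine ⟨-1, Or.inr rfl, fun j => ?_⟩
    simp only [elt_step_iff] at h
    induction j using Int.induction_on with
    | zero => exact ⟨0, by simp⟩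
    | pred j ih =>
      obtain ⟨i, hi⟩ := ih
      obtain ⟨i', hi'⟩ := h (-(j : ℤ) - 1)
      refine ⟨i' + i, ?_⟩
      rw [sub_add_cancel, hi] at hi'
      rw [hi', show -1 * (-(j : ℤ) - 1) = -1 * -(j : ℤ) + 1 by ring, g_succ]; ring
    | succ j ih =>
      obtain ⟨i, hi⟩ := ih
      obtain ⟨i', hi'⟩ := h j
      obtain ⟨i'', hi''⟩ := Z_pow_inv i'
      refine ⟨i'' + i, ?_⟩
      rw [hi, show -1 * (j : ℤ) = -1 * ((j : ℤ) + 1) + 1 by ring, g_succ] at hi'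
      apply mul_left_cancel₀ (Units.ne_zero Gu)
      rw [val_Gu]
      calc G * E (X ((j : ℤ) + 1)) = (Z ^ i'' * Z ^ i') * (G * E (X ((j : ℤ) + 1))) := by
            rw [hi'', one_mul]
        _ = Z ^ i'' * (Z ^ i' * G * E (X ((j : ℤ) + 1))) := by ring
        _ = _ := by rw [← hi']; ring

lemma IsIndexation.E_zero_ne {c : Coset} {X : ℤ → Tri} (h : IsIndexation c X) (hc : c ≠ 0) :
    E (X 0) ≠ 0 := by
  intro h0
  apply hc
  rw [← h.1 0, coset_eq, cos_eq_zero_iff, h0]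

theorem exists_isIndexation (c : Coset) : ∃ X, IsIndexation c X := by
  obtain ⟨x, rfl⟩ := cos_surjective c
  exact ⟨_, isIndexation_tri x 1 (Or.inl rfl)⟩

/-- Existence is the structure of the unit group; uniqueness holds because `q` ignores torsion and
is strictly monotone along the sequence. -/
theorem IsIndexation.existsUnique {c : Coset} {X : ℤ → Tri} (h : IsIndexation c X) (hc : c ≠ 0)
    (T : Tri) (hT : coset T = c) : ∃! j : ℤ, ∃ i : ℕ, elt T = zeta ^ i * elt (X j) := by
  simp only [elt_eq_iff]
  have hx := h.E_zero_ne hc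
  obtain ⟨δ, hδ, hX⟩ := h.exists_eq
  have hδδ : δ * δ = 1 := by rcases hδ with rfl | rfl <;> rfl
  have hass : Associated (E (X 0)) (E T) := by
    rw [← cos_eq_iff, ← coset_eq, ← coset_eq, hT, h.1 0]
  obtain ⟨i, k, hk⟩ := associated_iff.mp hass
  refine ⟨δ * k, ?_, ?_⟩
  · obtain ⟨i', hi'⟩ := hX (δ * k)
    obtain ⟨i'', hi''⟩ := Z_pow_inv i'
    rw [← mul_assoc, hδδ, one_mul] at hi'
    refine ⟨i + i'', ?_⟩
    rw [hk, hi', pow_add, mul_assoc, ← mul_assoc (Z ^ i''), hi'', one_mul]; rfl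
  · rintro j ⟨i', hi'⟩
    obtain ⟨i'', hi''⟩ := hX j
    have hq : q (E T) = q (g (δ * j) (E (X 0))) := by rw [hi', hi'']; simp
    have hq' : q (E T) = q (g k (E (X 0))) := by rw [hk]; simp [g]
    have := g_eq_index hx (hq'.symm.trans hq)
    rw [this, ← mul_assoc, hδδ, one_mul]

lemma even_delta {δ : ℤ} (hδ : δ = 1 ∨ δ = -1) (j : ℤ) : Even (δ * j) ↔ Even j := by
  rcases hδ with rfl | rfl <;> simp

theorem IsIndexation.signature_eq {c : Coset} {X : ℤ → Tri} (h : IsIndexation c X) :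
    ∃ a b : ℤ, ∀ j : ℤ, signature (X j) = if Even j then (a, b) else (b, a) := by
  obtain ⟨δ, hδ, hX⟩ := h.exists_eq
  refine ⟨(sg (E (X 0))).1, (sg (E (X 0))).2, fun j => ?_⟩
  obtain ⟨i, hi⟩ := hX j
  rw [HardCore.signature_eq, hi, sg_Z_pow, sg_g]
  simp only [even_delta hδ]
  rfl

/-! ### Near-equilateral triangles are minimizing -/

namespace Cyc

lemma norm_sg (x : Cyc) : p x ^ 2 - 3 * q x ^ 2 =
    (sg x).1 ^ 2 + (sg x).1 * (sg x).2 + (sg x).2 ^ 2 := by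
  rw [norm_eq]
  unfold sg lo mid hi
  rcases le_total (U x) (V x) with h1 | h1 <;> rcases le_total (V x) (W x) with h2 | h2 <;>
    rcases le_total (U x) (W x) with h3 | h3 <;> simp [h1, h2, h3] <;>
    first
    | ring1
    | (have e1 : U x = V x := by omega
       have e2 : V x = W x := by omega
       simp [e1, e2])

/-- Heron's formula in terms of the shortest side and the signature. -/
lemma four_q_sq (x : Cyc) : 4 * q x ^ 2 =
    3 * lo x ^ 2 + 2 * lo x * (2 * (sg x).1 + (sg x).2) - (sg x).2 ^ 2 := by
  have h := norm_sg x
  have hp := lo_eq x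
  have : 2 * p x = 3 * lo x + 2 * (sg x).1 + (sg x).2 := by linarith
  have h4 : 4 * p x ^ 2 = (3 * lo x + 2 * (sg x).1 + (sg x).2) ^ 2 := by rw [← this]; ring
  linarith

end Cyc

lemma eq_zero_of_sq_eq_three_mul_sq {x y : ℤ} (h : x ^ 2 = 3 * y ^ 2) : x = 0 ∧ y = 0 := by
  have h' : |(x : ℝ)| = |(y : ℝ)| * Real.sqrt 3 := by
    rw [← abs_of_nonneg (Real.sqrt_nonneg 3), ← abs_mul, ← sq_eq_sq_iff_abs_eq_abs, mul_pow,
      Real.sq_sqrt (by norm_num)]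
    have : (x : ℝ) ^ 2 = 3 * y ^ 2 := by exact_mod_cast h
    linarith
  have := eq_zero_of_sub_sqrt_three (a := |x|) (b := |y|) (by
    have h'' : ((|x| : ℤ) : ℝ) = ((|y| : ℤ) : ℝ) * Real.sqrt 3 := by push_cast; exact h'
    rw [sub_eq_zero]
    exact h'')
  simpa using this

/-- A quantitative form of the irrationality of `√3`: close solutions of Pell equations with small
right-hand sides coincide. -/
lemma pell_rigidity {M P Q x y N N' : ℤ} (hP : 0 ≤ P)
    (hx : |x| ≤ 2 * M) (hy0 : 0 ≤ y) (hy : y ≤ M) (hN : P ^ 2 - 3 * Q ^ 2 = N)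
    (hN' : (P - x) ^ 2 - 3 * (Q - y) ^ 2 = N') (hN0 : 0 ≤ N) (hN1 : N ≤ M ^ 2)
    (hN'0 : 0 ≤ N') (hN'1 : N' ≤ 16 * M ^ 2) (hQ : 100 * (M + 1) ^ 4 ≤ Q) : x = 0 ∧ y = 0 := by
  have hM : 0 ≤ M := hy0.trans hy
  have hQ0 : 0 ≤ Q := le_trans (by positivity) hQ
  apply eq_zero_of_sq_eq_three_mul_sq
  by_contra hne
  have hx2 : x ^ 2 ≤ 4 * M ^ 2 := by
    rw [← sq_abs]; nlinarith [abs_nonneg x]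
  have hy2 : y ^ 2 ≤ M ^ 2 := by nlinarith
  have hPQ : P ≤ 2 * Q + M := by
    by_contra h
    have : (2 * Q + M) ^ 2 < P ^ 2 := by apply pow_lt_pow_left₀ (by linarith) (by positivity); norm_num
    nlinarith [mul_nonneg hQ0 hM, sq_nonneg Q]
  -- Subtracting the two Pell equations gives `2t = N - N' + x² - 3y²`, so `t` is bounded in terms
  -- of `M` alone, however large `P` and `Q` are.
  set t := P * x - 3 * Q * y with ht
  have h2t : 2 * t = N' - N - x ^ 2 + 3 * y ^ 2 - 2 * (N' - N) + 2 * x ^ 2 - 6 * y ^ 2 := by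
    rw [← hN, ← hN', ht]; ring
  have hta : |t| ≤ 10 * M ^ 2 := by
    rw [abs_le]
    constructor <;> nlinarith [sq_nonneg x, sq_nonneg y, sq_nonneg M]
  have hsum : |P * x + 3 * Q * y| ≤ 7 * M * Q + 2 * M ^ 2 := by
    calc |P * x + 3 * Q * y| ≤ |P * x| + |3 * Q * y| := abs_add_le _ _
      _ = P * |x| + 3 * Q * y := by
        rw [abs_mul, abs_of_nonneg hP, abs_of_nonneg (by positivity : 0 ≤ 3 * Q * y)]
      _ ≤ (2 * Q + M) * (2 * M) + 3 * Q * M := by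
        gcongr
      _ = 7 * M * Q + 2 * M ^ 2 := by ring
  -- The left side grows at most linearly in `Q`, the right side quadratically unless `x² = 3y²`.
  have hprod : t * (P * x + 3 * Q * y) = 3 * Q ^ 2 * (x ^ 2 - 3 * y ^ 2) + N * x ^ 2 := by
    rw [ht, ← hN]; ring
  have hlow : 3 * Q ^ 2 ≤ |3 * Q ^ 2 * (x ^ 2 - 3 * y ^ 2)| := by
    rw [abs_mul, abs_of_nonneg (by positivity : 0 ≤ 3 * Q ^ 2)]
    have : 1 ≤ |x ^ 2 - 3 * y ^ 2| := Int.one_le_abs (sub_ne_zero.mpr hne)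
    nlinarith [sq_nonneg Q]
  have hNx : N * x ^ 2 ≤ M ^ 2 * (4 * M ^ 2) := by gcongr
  have hup : |3 * Q ^ 2 * (x ^ 2 - 3 * y ^ 2)| ≤
      10 * M ^ 2 * (7 * M * Q + 2 * M ^ 2) + M ^ 2 * (4 * M ^ 2) := by
    have he : 3 * Q ^ 2 * (x ^ 2 - 3 * y ^ 2) = t * (P * x + 3 * Q * y) - N * x ^ 2 := by
      rw [hprod]; ring
    rw [he]
    calc |t * (P * x + 3 * Q * y) - N * x ^ 2| ≤ |t * (P * x + 3 * Q * y)| + |N * x ^ 2| := abs_sub _ _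
      _ ≤ _ := by
        rw [abs_mul, abs_of_nonneg (by positivity : 0 ≤ N * x ^ 2)]
        gcongr
  have h1 : M ^ 3 ≤ (M + 1) ^ 4 := by nlinarith [pow_nonneg hM 3, pow_nonneg hM 2, pow_nonneg hM 4]
  have h2 : M ^ 4 ≤ (M + 1) ^ 4 := by gcongr; linarith
  have h3 : 1 ≤ (M + 1) ^ 4 := one_le_pow₀ (by linarith)
  have h4 : 70 * M ^ 3 * Q ≤ Q * Q := by
    apply mul_le_mul_of_nonneg_right _ hQ0; linarith
  have h5 : 24 * M ^ 4 ≤ Q := by linarith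
  nlinarith

/-- Let `e` be the excess of `lo y` over `lo x` and `(a', b')` the signature of `y`. Comparing areas
by Heron's formula gives `6e + 4a' + b' ≤ 4M`. Hence `p` changes by at most `2M`, `|q|` by at most
`M`, and the norm of `y` is at most `16M²`, as `pell_rigidity` requires. -/
lemma eq_of_admissible_of_area_le {x y : Cyc} {M : ℤ} (hM : hi x - lo x ≤ M)
    (hd : 200 * (M + 1) ^ 4 ≤ lo x) (hlo : lo x ≤ lo y) (hhi : hi y ≤ mid y + lo y)
    (hq : |q y| ≤ |q x|) : p y = p x ∧ |q y| = |q x| := by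
  have hx1 := lo_le_mid x; have hx2 := mid_le_hi x
  have hy1 := lo_le_mid y; have hy2 := mid_le_hi y
  have hM0 : 0 ≤ M := by omega
  have hpos : 1 ≤ (M + 1) ^ 4 := one_le_pow₀ (by linarith)
  have hd0 : 0 < lo x := by linarith
  have fx := four_q_sq x
  have fy := four_q_sq y
  have nx := norm_sg x
  have ny := norm_sg y
  have lx := lo_eq x
  have ly := lo_eq y
  have ha : 0 ≤ (sg x).1 := by simp [sg]; omega
  have hb : 0 ≤ (sg x).2 := by simp [sg]; omega
  have hab : (sg x).1 + (sg x).2 ≤ M := by simp [sg]; omega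
  have ha' : 0 ≤ (sg y).1 := by simp [sg]; omega
  have hb' : 0 ≤ (sg y).2 := by simp [sg]; omega
  have hb'' : (sg y).2 ≤ lo y := by simp [sg]; omega
  generalize (sg x).1 = a at *
  generalize (sg x).2 = b at *
  generalize (sg y).1 = a' at *
  generalize (sg y).2 = b' at *
  have hq2 : q y ^ 2 ≤ q x ^ 2 := sq_le_sq.mpr hq
  obtain ⟨e, he⟩ : ∃ e, lo y = lo x + e := ⟨lo y - lo x, by ring⟩
  have he0 : 0 ≤ e := by linarith
  generalize lo x = d at *
  generalize lo y = L at *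
  subst he
  have up : 4 * q x ^ 2 ≤ 3 * d ^ 2 + 4 * d * M := by
    have : d * (2 * a + b) ≤ d * (2 * M) := mul_le_mul_of_nonneg_left (by linarith) hd0.le
    linarith [sq_nonneg b]
  have low : 3 * d ^ 2 + d * (6 * e + 4 * a' + b') ≤ 4 * q y ^ 2 := by
    rw [fy]
    -- The angle condition enters here, as `b' ≤ lo y`: it controls the negative term of Heron's
    -- formula.
    have h1 : b' ^ 2 ≤ b' * (d + e) := by
      rw [sq]; exact mul_le_mul_of_nonneg_left hb'' hb'
    linarith [mul_nonneg he0 ha', mul_nonneg he0 hb', sq_nonneg e]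
  have hsum : 6 * e + 4 * a' + b' ≤ 4 * M := by
    by_contra h
    have : d * (4 * M) < d * (6 * e + 4 * a' + b') := mul_lt_mul_of_pos_left (by linarith) hd0
    linarith
  have hQx : |q x| ^ 2 = q x ^ 2 := sq_abs _
  have hQy : |q y| ^ 2 = q y ^ 2 := sq_abs _
  rw [← hQx] at up fx nx
  rw [← hQy] at low fy ny
  have hQ0 := abs_nonneg (q x)
  have hQ'0 := abs_nonneg (q y)
  generalize |q x| = Q at *
  generalize |q y| = Q' at *
  have hdQ' : d ≤ 2 * Q' := by
    have h1 : 0 ≤ d * (6 * e + 4 * a' + b') := by positivity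
    apply le_of_sq_le_sq _ (by linarith)
    linarith [sq_nonneg d]
  have hΔ : Q - Q' ≤ M := by
    by_contra h
    have h1 : 0 ≤ d * (6 * e + 4 * a' + b') := by positivity
    have h2 : (Q - Q') * (Q + Q') ≤ d * M := by linarith
    have h3 : (Q - Q') * d ≤ (Q - Q') * (Q + Q') := by
      apply mul_le_mul_of_nonneg_left _ (by linarith); linarith
    have h4 : d * M < d * (Q - Q') := mul_lt_mul_of_pos_left (by linarith) hd0
    linarith
  have key := pell_rigidity (M := M) (P := p x) (Q := Q) (x := p x - p y) (y := Q - Q')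
    (N := a ^ 2 + a * b + b ^ 2) (N' := a' ^ 2 + a' * b' + b' ^ 2) (by linarith)
    (by rw [abs_le]; constructor <;> linarith) (by linarith) hΔ nx
    (by rw [← ny]; ring) (by positivity)
    (by
      have h1 : a ^ 2 + a * b + b ^ 2 ≤ (a + b) ^ 2 := by linarith [mul_nonneg ha hb]
      have h2 : (a + b) ^ 2 ≤ M ^ 2 := by
        apply pow_le_pow_left₀ (by linarith); exact hab
      linarith) (by positivity)
    (by
      have : a' ^ 2 + a' * b' + b' ^ 2 ≤ (a' + b') ^ 2 := by linarith [mul_nonneg ha' hb']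
      have h2 : (a' + b') ^ 2 ≤ (4 * M) ^ 2 := by
        apply pow_le_pow_left₀ (by linarith); linarith
      linarith) (by linarith)
  constructor <;> linarith [key.1, key.2]

/-- The norms `a² + ab + b²` agree, and each lies between `3/4` and `1` times `(a + b)²` for
nonnegative `a`, `b`. -/
lemma sg_sum_le {x y : Cyc} (hp : p y = p x) (hq : |q y| = |q x|) :
    hi y - lo y ≤ 2 * (hi x - lo x) := by
  have nx := norm_sg x
  have ny := norm_sg y
  rw [hp, ← sq_abs (q y), hq, sq_abs, nx] at ny
  have hx1 := lo_le_mid x; have hx2 := mid_le_hi x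
  have hy1 := lo_le_mid y; have hy2 := mid_le_hi y
  simp only [sg] at ny
  have ha : 0 ≤ mid x - lo x := by linarith
  have hb : 0 ≤ hi x - mid x := by linarith
  have h1 : hi x - lo x = (mid x - lo x) + (hi x - mid x) := by ring
  have h2 : hi y - lo y = (mid y - lo y) + (hi y - mid y) := by ring
  rw [h1, h2]
  generalize mid x - lo x = a at *
  generalize hi x - mid x = b at *
  generalize mid y - lo y = a' at *
  generalize hi y - mid y = b' at *
  apply le_of_sq_le_sq _ (by linarith)
  nlinarith [mul_nonneg ha hb, sq_nonneg (a' - b'), sq_nonneg (a' + b')]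

/-- Two triangles on one side, of equal oriented area and equal sum of squared sides, are mirror
images; a nontrivial shift between their apices makes the side short. -/
lemma side_le_of_mirror {x y : Cyc} (hm : x.m = y.m) (hn : x.n = y.n) (hp : p x = p y)
    (hq : q x = q y) (hne : x ≠ y) : U x ≤ (W x - V x) ^ 2 := by
  obtain ⟨w1, w2, a1, a2⟩ := x
  obtain ⟨w1', w2', b1, b2⟩ := y
  simp only at hm hn
  subst hm hn
  obtain ⟨t1, rfl⟩ : ∃ t1, b1 = a1 + t1 := ⟨b1 - a1, by ring⟩
  obtain ⟨t2, rfl⟩ : ∃ t2, b2 = a2 + t2 := ⟨b2 - a2, by ring⟩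
  simp only [p, q] at hp hq
  have hc : w1 * t2 - w2 * t1 = 0 := by linear_combination -hq
  have ht : 0 < t1 ^ 2 + t2 ^ 2 := by
    by_contra h
    apply hne
    have h1 : t1 = 0 := by nlinarith
    have h2 : t2 = 0 := by nlinarith
    simp [h1, h2]
  have hd : t1 * (2 * a1 + t1 - w1) + t2 * (2 * a2 + t2 - w2) = 0 := by linear_combination -hp
  have hL : (w1 * t1 + w2 * t2) ^ 2 = (w1 ^ 2 + w2 ^ 2) * (t1 ^ 2 + t2 ^ 2) := by
    linear_combination -(w1 * t2 - w2 * t1) * hc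
  simp only [U, V, W]
  by_cases h0 : w1 * t1 + w2 * t2 = 0
  · rw [h0] at hL
    have : w1 ^ 2 + w2 ^ 2 ≤ 0 := by
      by_contra h
      have := mul_pos (lt_of_not_ge h) ht
      linarith
    nlinarith [sq_nonneg ((w1 - a1) ^ 2 + (w2 - a2) ^ 2 - (a1 ^ 2 + a2 ^ 2))]
  -- Equal areas make the shift `t` parallel to the side `w`, and equal `p` makes the apices
  -- symmetric in its perpendicular bisector. So `W - V` is the inner product of `w` and `t`, whose
  -- square is `|w|² |t|² ≥ |w|²`.
  · have h1 : (w1 * t1 + w2 * t2) * (w1 * (2 * a1 + t1 - w1) + w2 * (2 * a2 + t2 - w2)) = 0 := by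
      linear_combination (w1 ^ 2 + w2 ^ 2) * hd - (w1 * (2 * a2 + t2 - w2) - w2 * (2 * a1 + t1 - w1)) * hc
    have h2 := (mul_eq_zero.mp h1).resolve_left h0
    have h3 : (w1 - a1) ^ 2 + (w2 - a2) ^ 2 - (a1 ^ 2 + a2 ^ 2) = w1 * t1 + w2 * t2 := by
      linear_combination -h2
    rw [h3, hL]
    nlinarith [sq_nonneg w1, sq_nonneg w2]

lemma attainable_shortSq {T : Tri} (h : 0 < shortSq T) : Attainable (shortSq T) := by
  refine ⟨h, ?_⟩
  have hs : ∀ i, ∃ m n : ℕ, sideSq T i = m ^ 2 + n ^ 2 := fun i => ⟨_, _, rfl⟩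
  have : shortSq T = sideSq T 0 ∨ shortSq T = sideSq T 1 ∨ shortSq T = sideSq T 2 := by
    unfold shortSq; omega
  rcases this with h | h | h <;> rw [h] <;> exact hs _

/-- An admissible triangle of no larger area shares `p` and `|q|` with `T`. Conversely, equal `p`
and `|q|` bound the spread of the squared sides by `2M`, less than the shortest one, so the angle
condition is automatic. -/
theorem isMin_iff_of_large {T : Tri} {M : ℤ} (hM : hi (E T) - lo (E T) ≤ M)
    (hd : 200 * (M + 1) ^ 4 ≤ lo (E T)) (T' : Tri) :
    IsMin (shortSq T) T' ↔
      p (E T') = p (E T) ∧ |q (E T')| = |q (E T)| ∧ lo (E T) ≤ lo (E T') := by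
  have hx1 := lo_le_mid (E T); have hx2 := mid_le_hi (E T)
  have hM0 : 0 ≤ M := by omega
  have hdM : 200 * (M + 1) ≤ lo (E T) := by
    refine le_trans ?_ hd
    have : (M + 1) ^ 1 ≤ (M + 1) ^ 4 := pow_le_pow_right₀ (by linarith) (by norm_num)
    linarith
  have key : ∀ T'', Admissible (shortSq T) T'' → |q (E T'')| ≤ |q (E T)| →
      p (E T'') = p (E T) ∧ |q (E T'')| = |q (E T)| := by
    intro T'' h hq
    rw [admissible_iff, shortSq_cast] at h
    exact eq_of_admissible_of_area_le hM hd h.1 h.2 hq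
  have hT : Admissible (shortSq T) T := by
    rw [admissible_iff, shortSq_cast]; omega
  constructor
  · rintro ⟨h1, h2⟩
    have h3 := h2 T hT
    zify at h3
    rw [dblArea_cast, dblArea_cast] at h3
    have h4 := key T' h1 h3
    rw [admissible_iff, shortSq_cast] at h1
    exact ⟨h4.1, h4.2, h1.1⟩
  · rintro ⟨h1, h2, h3⟩
    refine ⟨?_, fun T'' h'' => ?_⟩
    · rw [admissible_iff, shortSq_cast]
      have := sg_sum_le h1 h2
      have := lo_le_mid (E T')
      omega
    · zify
      rw [dblArea_cast, dblArea_cast, h2]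
      by_contra h
      exact h (key T'' h'' (not_le.mp h).le).2.ge

/-- Two competing apices over one side would force that squared side to be at most `(2M)²` by
`side_le_of_mirror`. -/
theorem not_sliding_of_large {T : Tri} {M : ℤ} (hM : hi (E T) - lo (E T) ≤ M)
    (hd : 200 * (M + 1) ^ 4 ≤ lo (E T)) : ¬ Sliding (shortSq T) := by
  rintro ⟨O, W', A, B, hA, hB, hne, hpos, -, -⟩
  have hx1 := lo_le_mid (E T); have hx2 := mid_le_hi (E T)
  have hM0 : 0 ≤ M := by omega
  rw [isMin_iff_of_large hM hd] at hA hB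
  set x := E ![O, W', A] with hx
  set y := E ![O, W', B] with hy
  have hqx : q x = cross (W' - O) (A - O) := by simp [hx, q, E, cross]
  have hqy : q y = cross (W' - O) (B - O) := by simp [hy, q, E, cross]
  rw [← hqx, ← hqy] at hpos
  have hq : q x = q y := by
    rcases abs_eq_abs.mp (hA.2.1.trans hB.2.1.symm) with h | h
    · exact h
    · rw [h] at hpos; nlinarith [sq_nonneg (q y)]
  have h := side_le_of_mirror (x := x) (y := y) rfl rfl (hA.1.trans hB.1.symm) hq (by
    intro h
    apply hne
    rw [Cyc.ext_iff] at h
    simp [hx, hy, E] at h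
    exact Prod.ext h.1 h.2)
  have hs := sg_sum_le hA.1 hA.2.1
  have h1 : lo x ≤ U x := by unfold lo; omega
  have h2 : |W x - V x| ≤ 2 * M := by
    rw [abs_le]
    unfold hi lo at hs
    unfold hi lo at hM
    omega
  have h3 : (W x - V x) ^ 2 ≤ (2 * M) ^ 2 := sq_le_sq' (by linarith [(abs_le.mp h2).1]) (abs_le.mp h2).2
  have h4 : (M + 1) ^ 2 ≤ (M + 1) ^ 4 := pow_le_pow_right₀ (by linarith) (by norm_num)
  nlinarith [hA.2.2]

/-! ### All but finitely many members of a sequence are minimizing -/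

/-- A sufficient condition for a triangle to be minimizing for its shortest side. -/
def Large (T : Tri) : Prop := 200 * (hi (E T) - lo (E T) + 1) ^ 4 ≤ lo (E T)

lemma Large.isMin_iff {T : Tri} (h : Large T) (T' : Tri) : IsMin (shortSq T) T' ↔
    p (E T') = p (E T) ∧ |q (E T')| = |q (E T)| ∧ lo (E T) ≤ lo (E T') :=
  isMin_iff_of_large le_rfl h T'

lemma Large.not_sliding {T : Tri} (h : Large T) : ¬ Sliding (shortSq T) :=
  not_sliding_of_large le_rfl h

lemma Large.attainable {T : Tri} (h : Large T) : Attainable (shortSq T) := by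
  apply attainable_shortSq
  zify
  rw [shortSq_cast]
  have hx1 := lo_le_mid (E T); have hx2 := mid_le_hi (E T)
  have : 1 ≤ (hi (E T) - lo (E T) + 1) ^ 4 := one_le_pow₀ (by linarith)
  unfold Large at h
  linarith

lemma Large.isMTri {T : Tri} (h : Large T) : IsMTri T :=
  ⟨_, h.attainable, (h.isMin_iff T).mpr ⟨rfl, rfl, le_rfl⟩⟩

lemma IsIndexation.shift {c : Coset} {X : ℤ → Tri} (h : IsIndexation c X) :
    ∃ δ : ℤ, (δ = 1 ∨ δ = -1) ∧
      ∀ j k, ∃ i : ℕ, E (X (j + k)) = Z ^ i * g (δ * k) (E (X j)) := by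
  obtain ⟨δ, hδ, hX⟩ := h.exists_eq
  refine ⟨δ, hδ, fun j k => ?_⟩
  obtain ⟨i, hi⟩ := hX j
  obtain ⟨i', hi'⟩ := hX (j + k)
  obtain ⟨i'', hi''⟩ := Z_pow_inv i
  refine ⟨i' + i'', ?_⟩
  rw [hi', hi, mul_add, add_comm, g_add, g_mul, pow_add, mul_assoc, ← mul_assoc (Z ^ i''), hi'',
    one_mul]

lemma IsIndexation.E_ne {c : Coset} {X : ℤ → Tri} (h : IsIndexation c X) (hc : c ≠ 0) (j : ℤ) :
    E (X j) ≠ 0 := by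
  intro h0
  apply hc
  rw [← h.1 j, coset_eq, cos_eq_zero_iff, h0]

lemma finite_of_delta {δ : ℤ} (hδ : δ = 1 ∨ δ = -1) {P : ℤ → Prop} (h : {k | P k}.Finite) :
    {k | P (δ * k)}.Finite := by
  rcases hδ with rfl | rfl
  · simpa using h
  · simpa using finite_comp_neg h

lemma IsIndexation.finite_p_le {c : Coset} {X : ℤ → Tri} (h : IsIndexation c X) (hc : c ≠ 0)
    (C : ℤ) : {j | p (E (X j)) ≤ C}.Finite := by
  obtain ⟨δ, hδ, hX⟩ := h.exists_eq
  refine (finite_of_delta hδ (finite_p_g_le (h.E_zero_ne hc) C)).subset fun j hj => ?_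
  obtain ⟨i, hi⟩ := hX j
  have hj' : p (E (X j)) ≤ C := hj
  rw [hi, p_Z_mul] at hj'
  exact hj'

lemma IsIndexation.finite_lo_le {c : Coset} {X : ℤ → Tri} (h : IsIndexation c X) (hc : c ≠ 0)
    (C : ℤ) : {j | lo (E (X j)) ≤ C}.Finite := by
  obtain ⟨a, b, hab⟩ := h.signature_eq
  refine (h.finite_p_le hc (3 * C + 2 * |a| + 2 * |b|)).subset fun j hj => ?_
  have hj' : lo (E (X j)) ≤ C := hj
  change p (E (X j)) ≤ _
  have h1 := lo_eq (E (X j))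
  have h2 := hab j
  rw [HardCore.signature_eq] at h2
  have := le_abs_self a; have := le_abs_self b
  have := abs_nonneg a; have := abs_nonneg b
  have := p_pos (h.E_ne hc j)
  split_ifs at h2 <;> rw [h2] at h1 <;> simp only at h1 <;> linarith

lemma IsIndexation.finite_not_large {c : Coset} {X : ℤ → Tri} (h : IsIndexation c X) (hc : c ≠ 0) :
    {j | ¬ Large (X j)}.Finite := by
  obtain ⟨a, b, hab⟩ := h.signature_eq
  refine (h.finite_lo_le hc (200 * (a + b + 1) ^ 4)).subset fun j hj => ?_
  change lo (E (X j)) ≤ _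
  have hM : hi (E (X j)) - lo (E (X j)) = a + b := by
    have h2 := hab j
    rw [HardCore.signature_eq, sg] at h2
    split_ifs at h2 <;> simp only [Prod.mk.injEq] at h2 <;> linarith
  have hj' : ¬ Large (X j) := hj
  rw [Large, hM] at hj'
  exact (not_le.mp hj').le

theorem IsIndexation.finite_not_isMTri {c : Coset} {X : ℤ → Tri} (h : IsIndexation c X)
    (hc : c ≠ 0) : {j | ¬ IsMTri (X j)}.Finite :=
  (h.finite_not_large hc).subset fun _ hj hl => hj hl.isMTri

/-! ### The relation of belonging to one family -/

namespace Cyc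

/-- Equal relative norms up to conjugation: equal area and sum of squared sides. -/
def Sim (x y : Cyc) : Prop := p y = p x ∧ |q y| = |q x|

lemma Sim.refl (x : Cyc) : Sim x x := ⟨rfl, rfl⟩
lemma Sim.symm {x y : Cyc} (h : Sim x y) : Sim y x := ⟨h.1.symm, h.2.symm⟩
lemma Sim.trans {x y z : Cyc} (h : Sim x y) (h' : Sim y z) : Sim x z :=
  ⟨h'.1.trans h.1, h'.2.trans h.2⟩

lemma sim_Z_pow (i : ℕ) (x : Cyc) : Sim x (Z ^ i * x) := ⟨p_Z_mul i x, by rw [q_Z_mul]⟩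

lemma pq_g_eq {x y : Cyc} (k : ℤ) (hp : p y = p x) (hq : q y = q x) :
    p (g k y) = p (g k x) ∧ q (g k y) = q (g k x) := by
  simp only [g, p_mul, q_mul, hp, hq, and_self]

lemma pq_unit_inv (u : Cycˣ) : p ((u⁻¹ : Cycˣ) : Cyc) = p (u : Cyc) ∧
    q ((u⁻¹ : Cycˣ) : Cyc) = -q (u : Cyc) := by
  have hp := p_mul (u : Cyc) ((u⁻¹ : Cycˣ) : Cyc)
  have hq := q_mul (u : Cyc) ((u⁻¹ : Cycˣ) : Cyc)
  have hN := norm_unit u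
  rw [Units.mul_inv] at hp hq
  simp only [p_one, q_one] at hp hq
  constructor
  · linear_combination -p ((u⁻¹ : Cycˣ) : Cyc) * hN - p (u : Cyc) * hp + 3 * q (u : Cyc) * hq
  · linear_combination -q ((u⁻¹ : Cycˣ) : Cyc) * hN + q (u : Cyc) * hp - p (u : Cyc) * hq

/-- Changing the sign of `q` is `√3 ↦ -√3`, which inverts the norm `2 + √3` of `1 + ζ`. Sequences
with opposite `q` therefore run in opposite directions. -/
lemma pq_g_neg {x y : Cyc} (k : ℤ) (hp : p y = p x) (hq : q y = -q x) :
    p (g (-k) y) = p (g k x) ∧ q (g (-k) y) = -q (g k x) := by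
  obtain ⟨h1, h2⟩ := pq_unit_inv (Gu ^ k)
  simp only [g, p_mul, q_mul, hp, hq, zpow_neg, h1, h2]
  constructor <;> ring

lemma Sim.g {x y : Cyc} (h : Sim x y) (k : ℤ) :
    Sim (g k x) (g k y) ∨ Sim (Cyc.g (-k) x) (Cyc.g k y) := by
  rcases abs_eq_abs.mp h.2 with hq | hq
  · left
    obtain ⟨h1, h2⟩ := pq_g_eq k h.1 hq
    exact ⟨h1, by rw [h2]⟩
  · right
    obtain ⟨h1, h2⟩ := pq_g_neg (-k) h.1 hq
    rw [neg_neg] at h1 h2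
    exact ⟨h1, by rw [h2, abs_neg]⟩

/-- Membership in one family, on elements. -/
def Rel (x y : Cyc) : Prop := ∃ k : ℤ, Sim (g k x) y

lemma Rel.refl (x : Cyc) : Rel x x := ⟨0, by rw [g_zero]; exact Sim.refl x⟩

lemma Sim.rel {x y : Cyc} (h : Sim x y) : Rel x y := ⟨0, by rwa [g_zero]⟩

lemma Rel.symm {x y : Cyc} (h : Rel x y) : Rel y x := by
  obtain ⟨k, h⟩ := h
  have he : Cyc.g (-k) (Cyc.g k x) = x := by rw [← g_add, neg_add_cancel, g_zero]
  rcases h.symm.g (-k) with h' | h' <;> rw [he] at h'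
  · exact ⟨_, h'⟩
  · exact ⟨_, h'⟩

lemma Rel.trans {x y z : Cyc} (h : Rel x y) (h' : Rel y z) : Rel x z := by
  obtain ⟨k, h⟩ := h
  obtain ⟨l, h'⟩ := h'
  rcases h.g l with h'' | h'' <;> rw [← g_add] at h'' <;> exact ⟨_, h''.trans h'⟩

lemma rel_of_cos_eq {x y : Cyc} (h : cos x = cos y) : Rel x y := by
  obtain ⟨i, k, rfl⟩ := associated_iff.mp (cos_eq_iff.mp h)
  exact ⟨k, sim_Z_pow i _⟩

lemma Sim.ne_zero {x y : Cyc} (h : Sim x y) (hx : x ≠ 0) : y ≠ 0 := by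
  rintro rfl
  have := p_pos hx
  rw [← h.1] at this
  simp [p] at this

lemma Rel.ne_zero {x y : Cyc} (h : Rel x y) (hx : x ≠ 0) : y ≠ 0 := by
  obtain ⟨k, h⟩ := h
  exact h.ne_zero (g_ne_zero k hx)

lemma Rel.exists_sim {x y : Cyc} (h : Rel x y) : ∃ y', cos y' = cos y ∧ Sim x y' := by
  obtain ⟨k, h⟩ := h.symm
  exact ⟨g k y, by simpa using cos_g k 0 y, h.symm⟩

lemma finite_p_eq (C : ℤ) : {x : Cyc | p x = C}.Finite := by
  have hinj : Function.Injective fun x : Cyc => (x.m, x.n, x.k, x.l) := by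
    intro x y h
    simp only [Prod.mk.injEq] at h
    exact Cyc.ext h.1 h.2.1 h.2.2.1 h.2.2.2
  refine (((Set.finite_Icc (-(2 * C)) (2 * C)).prod ((Set.finite_Icc (-(2 * C)) (2 * C)).prod
    ((Set.finite_Icc (-(2 * C)) (2 * C)).prod (Set.finite_Icc (-(2 * C)) (2 * C))))).preimage
    hinj.injOn).subset ?_
  intro x hx
  have hx' : p x = C := hx
  have h2 := two_p x
  rw [hx'] at h2
  have hU := U_nonneg x; have hV := V_nonneg x; have hW := W_nonneg x
  have hb : ∀ a : ℤ, a ^ 2 ≤ 2 * C → -(2 * C) ≤ a ∧ a ≤ 2 * C := fun a ha => by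
    constructor <;> nlinarith
  have hU' : x.m ^ 2 + x.n ^ 2 ≤ 2 * C := by change U x ≤ _; linarith
  have hV' : x.k ^ 2 + x.l ^ 2 ≤ 2 * C := by change V x ≤ _; linarith
  have h1 := hb x.m (by nlinarith)
  have h2 := hb x.n (by nlinarith)
  have h3 := hb x.k (by nlinarith)
  have h4 := hb x.l (by nlinarith)
  simp [h1, h2, h3, h4]

end Cyc

/-! ### Compatible choices -/

/-- Recovers `p` from the values of `q` at two consecutive indices. -/
lemma q_recurrence {X : ℤ → Tri} {δ : ℤ} (hδ : δ = 1 ∨ δ = -1)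
    (h : ∀ j k, ∃ i : ℕ, E (X (j + k)) = Z ^ i * g (δ * k) (E (X j))) (j : ℤ) :
    q (E (X (j + 1))) = 2 * q (E (X j)) - δ * p (E (X j)) := by
  obtain ⟨i, hi⟩ := h j 1
  rw [hi, q_Z_mul]
  rcases hδ with rfl | rfl
  · rw [mul_one, g_one, q_G_mul]; ring
  · have : g (-1 * 1) (E (X j)) = Ginv * E (X j) := by simp [g]
    rw [this, q_mul]; simp

lemma IsIndexation.finite_bad {c : Coset} {X : ℤ → Tri} (h : IsIndexation c X) (hc : c ≠ 0) :
    {j | ¬ (IsMTri (X j) ∧ IsMTri (X (j + 1)) ∧ 0 < q (E (X j)) * q (E (X (j + 1))))}.Finite := by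
  have h1 := h.finite_not_isMTri hc
  have h2 : {j | ¬ IsMTri (X (j + 1))}.Finite := h1.preimage (add_left_injective 1).injOn
  have h3 : {j | q (E (X j)) * q (E (X (j + 1))) ≤ 0}.Finite := by
    obtain ⟨δ, hδ, hX⟩ := h.exists_eq
    have hf := finite_q_mul_q_nonpos (h.E_zero_ne hc)
    have he : ∀ j, q (E (X j)) = q (g (δ * j) (E (X 0))) := fun j => by
      obtain ⟨i, hi⟩ := hX j
      rw [hi, q_Z_mul]
    simp only [he]
    rcases hδ with rfl | rfl
    · simpa using hf
    · have := hf.preimage (f := fun j : ℤ => -j - 1) (by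
        intro a _ b _ hab
        simp only at hab
        linarith)
      refine this.subset fun j hj => ?_
      have hj' : q (g (-1 * j) (E (X 0))) * q (g (-1 * (j + 1)) (E (X 0))) ≤ 0 := hj
      change q (g (-j - 1) (E (X 0))) * q (g (-j - 1 + 1) (E (X 0))) ≤ 0
      rw [sub_add_cancel, show -j - 1 = -1 * (j + 1) by ring, show -j = -1 * j by ring, mul_comm]
      exact hj'
  refine ((h1.union h2).union h3).subset fun j hj => ?_
  by_contra hcon
  simp only [Set.mem_union, not_or] at hcon
  exact hj ⟨not_not.mp hcon.1.1, not_not.mp hcon.1.2, not_le.mp hcon.2⟩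

/-- Away from finitely many indices all triangles are M-triangles and consecutive `q` have one sign.
Equal areas at two such consecutive indices give equal `p` there, and unit multiplication carries
the agreement to every index. -/
theorem IsCompatible.sim {F : Set Coset} {X : Coset → ℤ → Tri} (h : IsCompatible F X)
    {c c' : Coset} (hc : c ∈ F) (hc' : c' ∈ F) (j : ℤ) : Sim (E (X c j)) (E (X c' j)) := by
  obtain ⟨hc0, hI⟩ := h.1 c hc
  obtain ⟨hc0', hI'⟩ := h.1 c' hc'
  obtain ⟨j₀, hj₀⟩ := ((hI.finite_bad hc0).union (hI'.finite_bad hc0')).infinite_compl.nonempty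
  simp only [Set.compl_union, Set.mem_inter_iff, Set.mem_compl_iff] at hj₀
  obtain ⟨h1, h2, h3⟩ := not_not.mp hj₀.1
  obtain ⟨h1', h2', h3'⟩ := not_not.mp hj₀.2
  have e1 := (dblArea_eq_iff _ _).mp (h.2 c hc c' hc' j₀ h1 h1')
  have e2 := (dblArea_eq_iff _ _).mp (h.2 c hc c' hc' (j₀ + 1) h2 h2')
  obtain ⟨δ, hδ, hX⟩ := hI.shift
  obtain ⟨δ', hδ', hX'⟩ := hI'.shift
  have r := q_recurrence hδ hX j₀
  have r' := q_recurrence hδ' hX' j₀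
  have pp := p_pos (hI.E_ne hc0 j₀)
  have pp' := p_pos (hI'.E_ne hc0' j₀)
  have key : (δ' = δ ∧ p (E (X c' j₀)) = p (E (X c j₀)) ∧ q (E (X c' j₀)) = q (E (X c j₀))) ∨
      (δ' = -δ ∧ p (E (X c' j₀)) = p (E (X c j₀)) ∧ q (E (X c' j₀)) = -q (E (X c j₀))) := by
    generalize q (E (X c j₀)) = Q at *
    generalize q (E (X c' j₀)) = Q' at *
    generalize q (E (X c (j₀ + 1))) = R at *
    generalize q (E (X c' (j₀ + 1))) = R' at *
    have hQ : Q ≠ 0 := by rintro rfl; simp at h3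
    -- Because `Q R` and `Q' R'` are positive, the two signs agree; positivity of both `p` then
    -- decides whether `δ' = δ` or `δ' = -δ`.
    rcases abs_eq_abs.mp e1 with rfl | rfl <;> rcases abs_eq_abs.mp e2 with rfl | rfl
    · left
      rcases hδ with rfl | rfl <;> rcases hδ' with rfl | rfl <;> simp <;> linarith
    · exfalso; linarith
    · exfalso; linarith
    · right
      rcases hδ with rfl | rfl <;> rcases hδ' with rfl | rfl <;> simp <;> linarith
  obtain ⟨i, hi⟩ := hX j₀ (j - j₀)
  obtain ⟨i', hi'⟩ := hX' j₀ (j - j₀)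
  rw [add_sub_cancel] at hi hi'
  rw [hi, hi']
  refine (sim_Z_pow _ _).symm.trans (Sim.trans ?_ (sim_Z_pow _ _))
  rcases key with ⟨rfl, hp, hq⟩ | ⟨rfl, hp, hq⟩
  · obtain ⟨a, b⟩ := pq_g_eq (δ' * (j - j₀)) hp hq
    exact ⟨a, by rw [b]⟩
  · obtain ⟨a, b⟩ := pq_g_neg (δ * (j - j₀)) hp hq
    rw [neg_mul]
    exact ⟨a, by rw [b, abs_neg]⟩

/-- The family of an element. -/
def Fam (x : Cyc) : Set Coset := {c | ∃ y, cos y = c ∧ Rel x y}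

lemma cos_mem_Fam_self (x : Cyc) : cos x ∈ Fam x := ⟨x, rfl, Rel.refl x⟩

lemma cos_mem_Fam {x y : Cyc} : cos y ∈ Fam x ↔ Rel x y := by
  constructor
  · rintro ⟨y', h, h'⟩
    exact h'.trans (rel_of_cos_eq h)
  · intro h
    exact ⟨y, rfl, h⟩

lemma ne_zero_of_mem_Fam {x : Cyc} (hx : x ≠ 0) {c : Coset} (hc : c ∈ Fam x) : c ≠ 0 := by
  obtain ⟨y, rfl, h⟩ := hc
  rw [Ne, cos_eq_zero_iff]
  exact h.ne_zero hx

/-- Each coset has a representative with the `p` and `|q|` of `x`; the sign of its `q` relative to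
that of `x` dictates the direction of indexation. -/
lemma exists_isCompatible_Fam {x : Cyc} (hx : x ≠ 0) : ∃ X, IsCompatible (Fam x) X := by
  have h : ∀ c ∈ Fam x, ∃ (y : Cyc) (δ : ℤ), (δ = 1 ∨ δ = -1) ∧ cos y = c ∧
      ∀ j, Sim (g j x) (g (δ * j) y) := by
    rintro _ ⟨y, rfl, h⟩
    obtain ⟨y', hy, h⟩ := h.exists_sim
    rcases abs_eq_abs.mp h.2 with hq | hq
    · refine ⟨y', 1, Or.inl rfl, hy, fun j => ?_⟩
      obtain ⟨a, b⟩ := pq_g_eq j h.1 hq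
      rw [one_mul]
      exact ⟨a, by rw [b]⟩
    · refine ⟨y', -1, Or.inr rfl, hy, fun j => ?_⟩
      obtain ⟨a, b⟩ := pq_g_neg j h.1 hq
      rw [neg_one_mul]
      exact ⟨a, by rw [b, abs_neg]⟩
  classical
  choose! y δ hδ hy hs using h
  refine ⟨fun c j => tri (g (δ c * j) (y c)), fun c hc => ⟨ne_zero_of_mem_Fam hx hc, ?_⟩,
    fun c hc c' hc' j _ _ => ?_⟩
  · have := isIndexation_tri (y c) (δ c) (hδ c hc)
    rwa [hy c hc] at this
  · rw [dblArea_eq_iff, E_tri, E_tri]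
    exact (((hs c hc j).symm).trans (hs c' hc' j)).2.symm

lemma IsCompatible.subset_Fam {F : Set Coset} {X : Coset → ℤ → Tri} (h : IsCompatible F X)
    {x : Cyc} (hx : cos x ∈ F) : F ⊆ Fam x := by
  intro c hc
  have h1 : cos (E (X c 0)) = c := (h.1 c hc).2.1 0
  have h2 : cos (E (X (cos x) 0)) = cos x := (h.1 _ hx).2.1 0
  exact ⟨_, h1, (rel_of_cos_eq h2.symm).trans (h.sim hx hc 0).rel⟩

theorem isMaxFamily_Fam {x : Cyc} (hx : x ≠ 0) : IsMaxFamily (Fam x) := by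
  refine ⟨exists_isCompatible_Fam hx, ?_⟩
  rintro F ⟨X, hX⟩ hF
  exact hX.subset_Fam (hF (cos_mem_Fam_self x))

lemma IsMaxFamily.eq_Fam {F : Set Coset} (hF : IsMaxFamily F) {x : Cyc} (hx : x ≠ 0)
    (h : cos x ∈ F) : F = Fam x := by
  obtain ⟨X, hX⟩ := hF.1
  have hsub := hX.subset_Fam h
  exact hsub.antisymm (hF.2 (exists_isCompatible_Fam hx) hsub)

lemma IsMaxFamily.exists_eq_Fam {F : Set Coset} (hF : IsMaxFamily F) :
    ∃ x : Cyc, x ≠ 0 ∧ F = Fam x := by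
  have hne : F.Nonempty := by
    by_contra h
    rw [Set.not_nonempty_iff_eq_empty] at h
    subst h
    exact hF.2 (exists_isCompatible_Fam one_ne_zero) (Set.empty_subset _) (cos_mem_Fam_self 1)
  obtain ⟨c, hc⟩ := hne
  obtain ⟨x, rfl⟩ := cos_surjective c
  obtain ⟨X, hX⟩ := hF.1
  have hx : x ≠ 0 := by
    have := (hX.1 _ hc).1
    rwa [Ne, cos_eq_zero_iff] at this
  exact ⟨x, hx, hF.eq_Fam hx hc⟩

theorem existsUnique_isMaxFamily (c : Coset) (hc : c ≠ 0) :
    ∃! F : Set Coset, IsMaxFamily F ∧ c ∈ F := by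
  obtain ⟨x, rfl⟩ := cos_surjective c
  rw [Ne, cos_eq_zero_iff] at hc
  exact ⟨Fam x, ⟨isMaxFamily_Fam hc, cos_mem_Fam_self x⟩, fun F hF => hF.1.eq_Fam hc hF.2⟩

lemma finite_Fam (x : Cyc) : (Fam x).Finite := by
  refine ((finite_p_eq (p x)).image cos).subset ?_
  rintro _ ⟨y, rfl, h⟩
  obtain ⟨y', hy, h⟩ := h.exists_sim
  exact ⟨y', h.1, hy⟩

/-! ### Conjugate members of one sequence -/

/-- The prime 2 is inert in the Eisenstein integers, so nonzero norms have even 2-adic valuation,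
unlike `6c²`. The proof is the corresponding descent. -/
lemma eq_zero_of_loeschian_eq_six_mul_sq (a b c : ℤ) (h : a ^ 2 + a * b + b ^ 2 = 6 * c ^ 2) :
    c = 0 := by
  induction hn : c.natAbs using Nat.strong_induction_on generalizing a b c with
  | _ n ih =>
    by_contra hc
    have hab : Even a ∧ Even b := by
      have h2 : Even (a ^ 2 + a * b + b ^ 2) := by rw [h]; exact ⟨3 * c ^ 2, by ring⟩
      rcases Int.even_or_odd a with ha | ha <;> rcases Int.even_or_odd b with hb | hb
      · exact ⟨ha, hb⟩
      all_goals
        exfalso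
        rcases ha with ⟨u, rfl⟩
        rcases hb with ⟨v, rfl⟩
        rcases h2 with ⟨w, hw⟩
        ring_nf at hw
        omega
    obtain ⟨⟨a', rfl⟩, ⟨b', rfl⟩⟩ := hab
    have h3 : 2 * (a' ^ 2 + a' * b' + b' ^ 2) = 3 * c ^ 2 := by linarith
    have hce : Even c := by
      have : Even (3 * c ^ 2) := by rw [← h3]; exact even_two_mul _
      rcases Int.even_mul.mp this with h | h
      · exact absurd h (by decide)
      · exact (Int.even_pow.mp h).1
    obtain ⟨c', rfl⟩ := hce
    have h4 : a' ^ 2 + a' * b' + b' ^ 2 = 6 * c' ^ 2 := by linarith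
    have := ih c'.natAbs (by omega) a' b' c' h4 rfl
    omega

namespace Cyc

lemma p_ne_three_mul_q {x : Cyc} (hx : x ≠ 0) : p x ≠ 3 * q x := by
  intro h
  have hN := norm_eq x
  have h0 := eq_zero_of_loeschian_eq_six_mul_sq (U x - V x) (V x - W x) (q x) (by
    rw [← hN, h]; ring)
  have := p_pos hx
  omega

/-- If `k = 2t + 1`, the symmetry of the sequence gives `p` the same value at `t` and `t + 1`, that
is `p = 3q` at `t`, and the norm would be `6q²`. -/
lemma even_of_conj {x : Cyc} (hx : x ≠ 0) {k : ℤ} (hp : p (g k x) = p x)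
    (hq : q (g k x) = -q x) : Even k := by
  by_contra hk
  rw [Int.not_even_iff_odd] at hk
  obtain ⟨t, rfl⟩ := hk
  apply p_ne_three_mul_q (g_ne_zero t hx)
  obtain ⟨h1, -⟩ := pq_g_neg t hp hq
  rw [← g_add, show -t + (2 * t + 1) = t + 1 by ring, g_succ, p_G_mul] at h1
  linarith

lemma sides_eq_of_cos_eq_of_sim {x y : Cyc} (hx : x ≠ 0) (hc : cos x = cos y) (hs : Sim x y) :
    sg y = sg x := by
  obtain ⟨i, k, rfl⟩ := associated_iff.mp (cos_eq_iff.mp hc)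
  change sg (Z ^ i * g k x) = _
  have hp : p (Z ^ i * g k x) = p x := hs.1
  have hq : |q (Z ^ i * g k x)| = |q x| := hs.2
  rw [p_Z_mul] at hp
  rw [q_Z_mul] at hq
  rw [sg_Z_pow, sg_g, if_pos]
  rcases abs_eq_abs.mp hq with hq | hq
  · have : k = 0 := g_eq_index hx (by rw [hq, g_zero])
    simp [this]
  · exact even_of_conj hx hp hq

/-! ### The class of an element -/

/-- Equal relative norms. -/
def SameNorm (x y : Cyc) : Prop := p y = p x ∧ q y = q x

/-- All elements of the same relative norm have one signature. -/
def UniqueSg (x : Cyc) : Prop :=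
  ∀ w w', SameNorm x w → SameNorm x w' → sg w = sg w'

/-- Elements of the same relative norm and signature are equal up to torsion and conjugation. -/
def UniqueElt (x : Cyc) : Prop :=
  ∀ w w', SameNorm x w → SameNorm x w' → sg w = sg w' → ∃ i : ℕ, w' = Z ^ i * w ∨ w' = Z ^ i * τ w

/-- The class to which the family of an element corresponds. -/
def EltClass (K : DClass) (x : Cyc) : Prop :=
  match K with
  | .A => UniqueSg x ∧ UniqueElt x
  | .B0 => UniqueSg x ∧ ¬ UniqueElt x
  | .B1 => ¬ UniqueSg x ∧ UniqueElt x
  | .B2 => ¬ UniqueSg x ∧ ¬ UniqueElt x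

lemma exists_eltClass (x : Cyc) : ∃ K, EltClass K x := by
  by_cases h1 : UniqueSg x <;> by_cases h2 : UniqueElt x
  · exact ⟨.A, h1, h2⟩
  · exact ⟨.B0, h1, h2⟩
  · exact ⟨.B1, h1, h2⟩
  · exact ⟨.B2, h1, h2⟩

lemma SameNorm.trans {x y z : Cyc} (h : SameNorm x y) (h' : SameNorm y z) : SameNorm x z :=
  ⟨h'.1.trans h.1, h'.2.trans h.2⟩
lemma SameNorm.g {x y : Cyc} (h : SameNorm x y) (k : ℤ) : SameNorm (g k x) (g k y) :=
  pq_g_eq k h.1 h.2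
lemma SameNorm.σ {x y : Cyc} (h : SameNorm x y) : SameNorm (σ x) (σ y) := by
  unfold SameNorm at *; simpa using h

lemma g_neg_g (k : ℤ) (x : Cyc) : g (-k) (g k x) = x := by rw [← g_add, neg_add_cancel, g_zero]
lemma g_g_neg (k : ℤ) (x : Cyc) : g k (g (-k) x) = x := by rw [← g_add, add_neg_cancel, g_zero]

lemma SameNorm.g_neg {x y : Cyc} {k : ℤ} (h : SameNorm (Cyc.g k x) y) :
    SameNorm x (Cyc.g (-k) y) := by
  have := h.g (-k)
  rwa [g_neg_g] at this

lemma sg_g_congr {x y : Cyc} (k : ℤ) (h : sg x = sg y) : sg (g k x) = sg (g k y) := by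
  rw [sg_g, sg_g, h]

/-- A unit divided by its complex conjugate has relative norm 1, hence is torsion. -/
lemma exists_g_τ (k : ℤ) (x : Cyc) : ∃ i : ℕ, g k (τ x) = Z ^ i * τ (g k x) := by
  have h1 := pq_unit_inv (Units.map (τ : Cyc →* Cyc) (Gu ^ k))
  have hN := norm_unit (Gu ^ k)
  have hinv : τ ((Gu ^ k : Cycˣ) : Cyc) *
      (((Units.map (τ : Cyc →* Cyc) (Gu ^ k))⁻¹ : Cycˣ) : Cyc) = 1 :=
    (Units.map (τ : Cyc →* Cyc) (Gu ^ k)).mul_inv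
  rw [Units.coe_map] at h1
  simp only [MonoidHom.coe_coe, p_τ, q_τ] at h1
  obtain ⟨i, hi⟩ := eq_Z_pow (x := ((Gu ^ k : Cycˣ) : Cyc) *
      (((Units.map (τ : Cyc →* Cyc) (Gu ^ k))⁻¹ : Cycˣ) : Cyc))
    (by rw [p_mul, h1.1, h1.2]; linear_combination hN)
    (by rw [q_mul, h1.1, h1.2]; ring)
  refine ⟨i, ?_⟩
  rw [← hi, g, g, map_mul]
  linear_combination -((Gu ^ k : Cycˣ) : Cyc) * τ x * hinv

lemma UniqueSg.g {x : Cyc} (h : UniqueSg x) (k : ℤ) : UniqueSg (g k x) := by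
  intro w w' hw hw'
  have := sg_g_congr k (h _ _ hw.g_neg hw'.g_neg)
  rwa [g_g_neg, g_g_neg] at this

lemma UniqueElt.g {x : Cyc} (h : UniqueElt x) (k : ℤ) : UniqueElt (g k x) := by
  intro w w' hw hw' hs
  obtain ⟨i, hi⟩ := h _ _ hw.g_neg hw'.g_neg (sg_g_congr (-k) hs)
  have hw' := g_g_neg k w'
  rcases hi with hi | hi
  · exact ⟨i, Or.inl (by rw [← hw', hi, g_mul, g_g_neg])⟩
  · obtain ⟨i', hi'⟩ := exists_g_τ k (Cyc.g (-k) w)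
    refine ⟨i + i', Or.inr ?_⟩
    rw [← hw', hi, g_mul, hi', g_g_neg, pow_add, mul_assoc]

lemma UniqueSg.σ {x : Cyc} (h : UniqueSg x) : UniqueSg (σ x) := by
  intro w w' hw hw'
  have := h (Cyc.σ w) (Cyc.σ w') (by simpa using hw.σ) (by simpa using hw'.σ)
  simpa using this

lemma UniqueElt.σ {x : Cyc} (h : UniqueElt x) : UniqueElt (σ x) := by
  intro w w' hw hw' hs
  obtain ⟨i, hi⟩ := h (Cyc.σ w) (Cyc.σ w') (by simpa using hw.σ) (by simpa using hw'.σ)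
    (by simpa using hs)
  refine ⟨5 * i, ?_⟩
  rw [pow_mul, ← σ_Z, ← map_pow, ← σσ w']
  rcases hi with hi | hi
  · left; rw [hi, map_mul, σσ]
  · right; rw [hi, map_mul, τσ, ση]

lemma UniqueSg.of_sameNorm {x y : Cyc} (h : UniqueSg x) (hs : SameNorm x y) : UniqueSg y :=
  fun w w' hw hw' => h w w' (hs.trans hw) (hs.trans hw')

lemma UniqueElt.of_sameNorm {x y : Cyc} (h : UniqueElt x) (hs : SameNorm x y) : UniqueElt y :=
  fun w w' hw hw' => h w w' (hs.trans hw) (hs.trans hw')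

lemma Sim.sameNorm_or {x y : Cyc} (h : Sim x y) : SameNorm x y ∨ SameNorm (σ x) y := by
  rcases abs_eq_abs.mp h.2 with hq | hq
  · exact Or.inl ⟨h.1, hq⟩
  · exact Or.inr ⟨by simpa using h.1, by simpa using hq⟩

lemma Rel.uniqueSg {x y : Cyc} (h : Rel x y) (hx : UniqueSg x) : UniqueSg y := by
  obtain ⟨k, h⟩ := h
  rcases h.sameNorm_or with h | h
  · exact (hx.g k).of_sameNorm h
  · exact (hx.g k).σ.of_sameNorm h

lemma Rel.uniqueElt {x y : Cyc} (h : Rel x y) (hx : UniqueElt x) : UniqueElt y := by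
  obtain ⟨k, h⟩ := h
  rcases h.sameNorm_or with h | h
  · exact (hx.g k).of_sameNorm h
  · exact (hx.g k).σ.of_sameNorm h

lemma Rel.eltClass {K : DClass} {x y : Cyc} (h : Rel x y) (hx : EltClass K x) : EltClass K y := by
  have h1 : UniqueSg x ↔ UniqueSg y := ⟨h.uniqueSg, h.symm.uniqueSg⟩
  have h2 : UniqueElt x ↔ UniqueElt y := ⟨h.uniqueElt, h.symm.uniqueElt⟩
  cases K <;> simpa only [EltClass, h1, h2] using hx

end Cyc

/-! ### The class of a value -/

lemma sideType_eq_of_z2Congruent {T T' : Tri} (h : Z2Congruent T T') :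
    sideType T = sideType T' := by
  obtain ⟨h1, h2, h3, -⟩ := (z2Congruent_iff.mp h).invariants
  rw [sideType_eq_iff]
  exact ⟨h1.symm, h2.symm, h3.symm⟩

/-- The four classes are the four truth values of two predicates, so that exclusivity and
exhaustiveness become propositional. -/
lemma inClass_iff (K : DClass) (d : ℕ) : InClass K d ↔ Attainable d ∧ ¬ Sliding d ∧
    match K with
    | .A => UniqueType d ∧ UniqueImplementation d
    | .B0 => UniqueType d ∧ ¬ UniqueImplementation d
    | .B1 => ¬ UniqueType d ∧ UniqueImplementation d
    | .B2 => ¬ UniqueType d ∧ ¬ UniqueImplementation d := by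
  cases K <;> simp only [InClass, and_congr_right_iff] <;> intro _ _
  · constructor
    · intro h
      exact ⟨fun T T' hT hT' => sideType_eq_of_z2Congruent (h T T' hT hT'),
        fun T T' hT hT' _ => h T T' hT hT'⟩
    · intro h T T' hT hT'
      exact h.2 T T' hT hT' (h.1 T T' hT hT')
  · intro hU
    constructor
    · rintro ⟨T, T', hT, hT', h⟩ hI
      exact h (hI T T' hT hT' (hU T T' hT hT'))
    · intro h
      unfold UniqueImplementation at h
      push Not at h
      obtain ⟨T, T', hT, hT', -, h⟩ := h
      exact ⟨T, T', hT, hT', h⟩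

lemma InClass.unique {K K' : DClass} {d : ℕ} (h : InClass K d) (h' : InClass K' d) : K = K' := by
  rw [inClass_iff] at h h'
  cases K <;> cases K' <;> simp only at h h' <;> tauto

theorem existsUnique_inClass (d : ℕ) (hd : Attainable d) (hs : ¬ Sliding d) :
    ∃! K : DClass, InClass K d := by
  have : ∃ K, InClass K d := by
    simp only [inClass_iff]
    by_cases h1 : UniqueType d <;> by_cases h2 : UniqueImplementation d
    · exact ⟨.A, hd, hs, h1, h2⟩
    · exact ⟨.B0, hd, hs, h1, h2⟩
    · exact ⟨.B1, hd, hs, h1, h2⟩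
    · exact ⟨.B2, hd, hs, h1, h2⟩
  obtain ⟨K, hK⟩ := this
  exact ⟨K, hK, fun K' hK' => hK'.unique hK⟩

/-- Exchanging two vertices by `σ` normalizes the orientation. -/
lemma exists_sameNorm_of_sim {z : Cyc} {T : Tri} (h : Sim z (E T)) :
    ∃ w, SameNorm z w ∧ Cong (E T) w ∧ Cong w (E T) := by
  rcases abs_eq_abs.mp h.2 with hq | hq
  · exact ⟨E T, ⟨h.1, hq⟩, ⟨0, Or.inl (by simp)⟩, ⟨0, Or.inl (by simp)⟩⟩
  · exact ⟨σ (E T), ⟨by simpa using h.1, by simp [hq]⟩, ⟨0, Or.inr (Or.inr (Or.inl (by simp)))⟩,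
      ⟨0, Or.inr (Or.inr (Or.inl (by simp)))⟩⟩

lemma sg_eq_of_sides {x y : Cyc} (h : lo x = lo y ∧ mid x = mid y ∧ hi x = hi y) :
    sg x = sg y := by
  simp [sg, h.1, h.2.1, h.2.2]

lemma uniqueType_iff {z : Cyc} {d : ℕ} (hmin : ∀ T, IsMin d T ↔ Sim z (E T)) :
     UniqueType d ↔ UniqueSg z := by
  constructor
  · intro h w w' hw hw'
    have := h (tri w) (tri w') ((hmin _).mpr (by rw [E_tri]; exact ⟨hw.1, by rw [hw.2]⟩))
      ((hmin _).mpr (by rw [E_tri]; exact ⟨hw'.1, by rw [hw'.2]⟩))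
    rw [sideType_eq_iff, E_tri, E_tri] at this
    exact sg_eq_of_sides this
  · intro h T T' hT hT'
    rw [hmin] at hT hT'
    obtain ⟨w, hw, hc, -⟩ := exists_sameNorm_of_sim hT
    obtain ⟨w', hw', hc', -⟩ := exists_sameNorm_of_sim hT'
    have h1 := sides_eq_of_sg (hw.1.trans hw'.1.symm) (h w w' hw hw')
    have h2 := hc.invariants
    have h3 := hc'.invariants
    rw [sideType_eq_iff]
    omega

/-- Between elements of equal `q ≠ 0` a congruence cannot involve `σ` or `η`, which reverse
orientation; torsion and complex conjugation remain. -/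
lemma uniqueImplementation_iff {z : Cyc} {d : ℕ} (hmin : ∀ T, IsMin d T ↔ Sim z (E T))
    (hq : q z ≠ 0) : UniqueImplementation d ↔ UniqueElt z := by
  constructor
  · intro h w w' hw hw' hs
    have := h (tri w) (tri w') ((hmin _).mpr (by rw [E_tri]; exact ⟨hw.1, by rw [hw.2]⟩))
      ((hmin _).mpr (by rw [E_tri]; exact ⟨hw'.1, by rw [hw'.2]⟩))
      (by
        rw [sideType_eq_iff, E_tri, E_tri]
        exact sides_eq_of_sg (hw.1.trans hw'.1.symm) hs)
    rw [z2Congruent_iff, E_tri, E_tri] at this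
    obtain ⟨i, h | h | h | h⟩ := this
    · exact ⟨i, Or.inl h⟩
    · exact ⟨i, Or.inr h⟩
    · exfalso
      have h1 : q w' = -q w := by rw [h]; simp
      rw [hw.2, hw'.2] at h1
      omega
    · exfalso
      have h1 : q w' = -q w := by rw [h]; simp
      rw [hw.2, hw'.2] at h1
      omega
  · intro h T T' hT hT' hs
    rw [hmin] at hT hT'
    obtain ⟨w, hw, hc, -⟩ := exists_sameNorm_of_sim hT
    obtain ⟨w', hw', hc', hc''⟩ := exists_sameNorm_of_sim hT'
    have h2 := hc.invariants
    have h3 := hc'.invariants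
    rw [sideType_eq_iff] at hs
    obtain ⟨i, hi⟩ := h w w' hw hw' (sg_eq_of_sides (by omega))
    rw [z2Congruent_iff]
    refine (hc.trans ⟨i, ?_⟩).trans hc''
    tauto

lemma inClass_iff_eltClass {z : Cyc} {d : ℕ} (hmin : ∀ T, IsMin d T ↔ Sim z (E T))
    (hq : q z ≠ 0) (ha : Attainable d) (hs : ¬ Sliding d) (K : DClass) :
    InClass K d ↔ EltClass K z := by
  rw [inClass_iff]
  cases K <;> simp only [EltClass, uniqueType_iff hmin, uniqueImplementation_iff hmin hq] <;> tauto

/-! ### The class of a family -/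

/-- The indices at which all triangles of a family are large and nondegenerate. -/
def GoodIndex (F : Set Coset) (X : Coset → ℤ → Tri) (j : ℤ) : Prop :=
  ∀ c ∈ F, Large (X c j) ∧ q (E (X c j)) ≠ 0

lemma IsCompatible.finite_not_goodIndex {F : Set Coset} {X : Coset → ℤ → Tri}
    (h : IsCompatible F X) (hF : F.Finite) : {j | ¬ GoodIndex F X j}.Finite := by
  have : {j | ¬ GoodIndex F X j} ⊆
      ⋃ c ∈ F, ({j | ¬ Large (X c j)} ∪
        {j | ¬ (IsMTri (X c j) ∧ IsMTri (X c (j + 1)) ∧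
          0 < q (E (X c j)) * q (E (X c (j + 1))))}) := by
    intro j hj
    have hj' : ¬ GoodIndex F X j := hj
    unfold GoodIndex at hj'
    push Not at hj'
    obtain ⟨c, hc, hj'⟩ := hj'
    rw [Set.mem_iUnion₂]
    refine ⟨c, hc, ?_⟩
    by_cases hl : Large (X c j)
    · right
      rintro ⟨-, -, hpos⟩
      rw [hj' hl, zero_mul] at hpos
      exact lt_irrefl _ hpos
    · exact Or.inl hl
  refine (hF.biUnion fun c hc => ?_).subset this
  obtain ⟨hc0, hI⟩ := h.1 c hc
  exact (hI.finite_not_large hc0).union (hI.finite_bad hc0)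

lemma GoodIndex.exists_isLeast {F : Set Coset} {X : Coset → ℤ → Tri} {j : ℤ}
    (h : GoodIndex F X j) (hF : F.Nonempty) :
    ∃ c ∈ F, IsLeast (shortSides F X j) (shortSq (X c j)) := by
  have hne : (shortSides F X j).Nonempty := by
    obtain ⟨c, hc⟩ := hF
    exact ⟨_, c, hc, (h c hc).1.isMTri, rfl⟩
  have hmem := Nat.sInf_mem hne
  obtain ⟨c, hc, -, he⟩ := id hmem
  refine ⟨c, hc, ?_⟩
  rw [← he]
  exact ⟨hmem, fun n hn => Nat.sInf_le hn⟩

/-- Any `T` with the right `p` and `|q|` belongs to a coset of the family and, by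
`sides_eq_of_cos_eq_of_sim`, has the sides of the member of that coset with index `j`. So its
shortest side is at least `D_j`, and the third condition of `Large.isMin_iff` is free. -/
lemma IsCompatible.isMin_iff {x : Cyc} {X : Coset → ℤ → Tri}
    (h : IsCompatible (Fam x) X) {j : ℤ} (hj : GoodIndex (Fam x) X j) {c : Coset}
    (hc : c ∈ Fam x) (hl : IsLeast (shortSides (Fam x) X j) (shortSq (X c j))) (T : Tri) :
    IsMin (shortSq (X c j)) T ↔ Sim (E (X c j)) (E T) := by
  rw [(hj c hc).1.isMin_iff]
  refine ⟨fun h => ⟨h.1, h.2.1⟩, fun hs => ⟨hs.1, hs.2, ?_⟩⟩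
  have hmem : cos (E T) ∈ Fam x := by
    rw [cos_mem_Fam]
    have h1 : cos (E (X c j)) = c := (h.1 c hc).2.1 j
    rw [← h1, cos_mem_Fam] at hc
    exact hc.trans hs.rel
  have hsv := h.sim hc hmem j
  have hcv : cos (E (X (cos (E T)) j)) = cos (E T) := (h.1 _ hmem).2.1 j
  have hne := (h.1 _ hmem).2.E_ne (h.1 _ hmem).1 j
  have hsg := sides_eq_of_cos_eq_of_sim hne hcv (hsv.symm.trans hs)
  have hlo := (sides_eq_of_sg (hs.1.trans hsv.1.symm) hsg).1
  rw [hlo, ← shortSq_cast, ← shortSq_cast]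
  exact_mod_cast hl.2 ⟨_, hmem, (hj _ hmem).1.isMTri, rfl⟩

theorem familyOfClass_Fam {x : Cyc} {K : DClass} (hK : EltClass K x) :
    FamilyOfClass (Fam x) K := by
  intro X h
  refine (h.finite_not_goodIndex (finite_Fam x)).subset fun j hj hg => hj ?_
  obtain ⟨c, hc, hl⟩ := hg.exists_isLeast ⟨_, cos_mem_Fam_self x⟩
  refine ⟨_, hl, ?_⟩
  rw [inClass_iff_eltClass (h.isMin_iff hg hc hl) (hg c hc).2 (hg c hc).1.attainable
    (hg c hc).1.not_sliding]
  have h1 : cos (E (X c j)) = c := (h.1 c hc).2.1 j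
  rw [← h1, cos_mem_Fam] at hc
  exact hc.eltClass hK

lemma FamilyOfClass.unique {F : Set Coset} {K K' : DClass} (hF : IsMaxFamily F)
    (h : FamilyOfClass F K) (h' : FamilyOfClass F K') : K = K' := by
  obtain ⟨X, hX⟩ := hF.1
  obtain ⟨j, hj⟩ := ((h X hX).union (h' X hX)).infinite_compl.nonempty
  simp only [Set.compl_union, Set.mem_inter_iff, Set.mem_compl_iff] at hj
  obtain ⟨d, hd, hc⟩ := not_not.mp hj.1
  obtain ⟨d', hd', hc'⟩ := not_not.mp hj.2
  rw [hd.unique hd'] at hc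
  exact hc.unique hc'

theorem infinite_shortSides {x : Cyc} {X : Coset → ℤ → Tri}
    (h : IsCompatible (Fam x) X) : {d : ℕ | ∃ j : ℤ, IsLeast (shortSides (Fam x) X j) d}.Infinite := by
  intro hfin
  obtain ⟨B, hB⟩ := hfin.bddAbove
  have hf : (⋃ c ∈ Fam x, {j | lo (E (X c j)) ≤ B}).Finite :=
    (finite_Fam x).biUnion fun c hc => (h.1 c hc).2.finite_lo_le (h.1 c hc).1 B
  obtain ⟨j, hj⟩ := ((h.finite_not_goodIndex (finite_Fam x)).union hf).infinite_compl.nonempty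
  simp only [Set.compl_union, Set.mem_inter_iff, Set.mem_compl_iff] at hj
  obtain ⟨c, hc, hl⟩ := GoodIndex.exists_isLeast (not_not.mp hj.1) ⟨_, cos_mem_Fam_self x⟩
  apply hj.2
  rw [Set.mem_iUnion₂]
  refine ⟨c, hc, ?_⟩
  change lo (E (X c j)) ≤ B
  rw [← shortSq_cast]
  exact_mod_cast hB ⟨j, hl⟩

theorem existsUnique_familyOfClass {F : Set Coset} (hF : IsMaxFamily F) :
    ∃! K : DClass, FamilyOfClass F K := by
  obtain ⟨x, hx, rfl⟩ := hF.exists_eq_Fam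
  obtain ⟨K, hK⟩ := exists_eltClass x
  exact ⟨K, familyOfClass_Fam hK, fun K' hK' => hK'.unique hF (familyOfClass_Fam hK)⟩

theorem FamilyOfClass.infinite_inClass {x : Cyc} (hx : x ≠ 0) {K : DClass}
    (hK : FamilyOfClass (Fam x) K) : {d : ℕ | InClass K d}.Infinite := by
  obtain ⟨X, h⟩ := exists_isCompatible_Fam hx
  intro hfin
  obtain ⟨B, hB⟩ := hfin.bddAbove
  have hf : (⋃ c ∈ Fam x, {j | lo (E (X c j)) ≤ B}).Finite :=
    (finite_Fam x).biUnion fun c hc => (h.1 c hc).2.finite_lo_le (h.1 c hc).1 B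
  obtain ⟨j, hj⟩ := ((hK X h).union hf).infinite_compl.nonempty
  simp only [Set.compl_union, Set.mem_inter_iff, Set.mem_compl_iff] at hj
  obtain ⟨d, hd, hc⟩ := not_not.mp hj.1
  obtain ⟨c, hcF, -, rfl⟩ := hd.1
  apply hj.2
  rw [Set.mem_iUnion₂]
  refine ⟨c, hcF, ?_⟩
  change lo (E (X c j)) ≤ B
  rw [← shortSq_cast]
  exact_mod_cast hB hc

namespace Cyc

/-! ### A prime over 5 and a prime over 13 -/

/-- The prime `2 + i`, which is inert over the Gaussian integers. -/
def lam : Cyc := ⟨2, 1, 2, 1⟩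

/-- A prime of norm 13. -/
def pr : Cyc := ⟨1, 0, -1, 1⟩

/-- The reduction modulo `pr`. -/
def redPr : Cyc →+* ZMod 13 where
  -- This is `ζ ↦ 11 = -2`, a primitive 12th root of unity modulo 13; the coefficients are the
  -- images of `ζ¹⁰, ζ, ζ², ζ⁵`.
  toFun x := 10 * (x.m : ZMod 13) + 11 * x.n + 4 * x.k + 7 * x.l
  map_zero' := by simp
  map_one' := by simp; decide
  map_add' x y := by simp; ring
  map_mul' x y := by
    have h13 : (13 : ZMod 13) = 0 := by decide
    simp only [mul_m, mul_n, mul_k, mul_l]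
    push_cast
    linear_combination ((-8) * x.m * y.m + (-9) * x.m * y.n + (-2) * x.m * y.k + (-4) * x.m * y.l + (-9) * x.n * y.m + (-9) * x.n * y.n + (-2) * x.n * y.k + (-7) * x.n * y.l + (-2) * x.k * y.m + (-2) * x.k * y.n + (-2) * x.k * y.k + (-3) * x.k * y.l + (-4) * x.l * y.m + (-7) * x.l * y.n + (-3) * x.l * y.k + (-3) * x.l * y.l : ZMod 13) * h13

lemma redPr_apply (x : Cyc) : redPr x = ((10 * x.m + 11 * x.n + 4 * x.k + 7 * x.l : ℤ) : ZMod 13) := by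
  simp [redPr]

lemma redPr_pr : redPr pr = 0 := by rw [redPr_apply]; decide

lemma pr_dvd_iff (x : Cyc) : pr ∣ x ↔ redPr x = 0 := by
  constructor
  · rintro ⟨y, rfl⟩
    rw [map_mul, redPr_pr, zero_mul]
  · intro h
    rw [redPr_apply, ZMod.intCast_zmod_eq_zero_iff_dvd] at h
    -- This cofactor times `pr` is 13, so divisibility by `pr` is tested by multiplying with it and
    -- dividing by 13.
    have hc : (⟨-5, -1, 2, 3⟩ : Cyc) ≠ 0 := by decide
    have h1 : (13 : ℤ) ∣ (x * ⟨-5, -1, 2, 3⟩).m := by simp only [mul_m]; omega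
    have h2 : (13 : ℤ) ∣ (x * ⟨-5, -1, 2, 3⟩).n := by simp only [mul_n]; omega
    have h3 : (13 : ℤ) ∣ (x * ⟨-5, -1, 2, 3⟩).k := by simp only [mul_k]; omega
    have h4 : (13 : ℤ) ∣ (x * ⟨-5, -1, 2, 3⟩).l := by simp only [mul_l]; omega
    obtain ⟨a, ha⟩ := h1
    obtain ⟨b, hb⟩ := h2
    obtain ⟨c, hc'⟩ := h3
    obtain ⟨d, hd⟩ := h4
    refine ⟨⟨a, b, c, d⟩, mul_right_cancel₀ hc ?_⟩
    have e1 : x * ⟨-5, -1, 2, 3⟩ = ⟨13, 0, 13, 0⟩ * ⟨a, b, c, d⟩ := by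
      apply Cyc.ext
      · rw [ha]; simp
      · rw [hb]; simp
      · rw [hc']; simp
      · rw [hd]; simp
    have e2 : pr * ⟨-5, -1, 2, 3⟩ = ⟨13, 0, 13, 0⟩ := by decide
    rw [e1, ← e2]; ring

lemma prime_pr : Prime pr := by
  refine ⟨by decide, ?_, ?_⟩
  · rintro ⟨u, hu⟩
    have := norm_unit u
    rw [hu] at this
    revert this; decide
  · intro a b h
    simp only [pr_dvd_iff, map_mul] at *
    have : Fact (Nat.Prime 13) := ⟨by norm_num⟩
    exact mul_eq_zero.mp h

/-- Modulo `2 + i` one has `i = 3` in `𝔽₅`, and each vertex is reduced separately. -/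
lemma lam_dvd_iff (x : Cyc) : lam ∣ x ↔
    ((x.m + 3 * x.n : ℤ) : ZMod 5) = 0 ∧ ((x.k + 3 * x.l : ℤ) : ZMod 5) = 0 := by
  simp only [ZMod.intCast_zmod_eq_zero_iff_dvd]
  have hl : ∀ y : Cyc, lam * y = ⟨2 * y.m - y.n, 2 * y.n + y.m, 2 * y.k - y.l, 2 * y.l + y.k⟩ := by
    intro y; ext <;> simp [lam]
  constructor
  · rintro ⟨y, rfl⟩
    rw [hl]
    constructor <;> simp only <;> omega
  · rintro ⟨⟨a, ha⟩, ⟨b, hb⟩⟩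
    refine ⟨⟨2 * a - x.n, x.n - a, 2 * b - x.l, x.l - b⟩, ?_⟩
    rw [hl]
    ext <;> simp only <;> push_cast at ha hb <;> omega

lemma prime_lam : Prime lam := by
  refine ⟨by decide, ?_, ?_⟩
  · rintro ⟨u, hu⟩
    have := norm_unit u
    rw [hu] at this
    revert this; decide
  · intro x y h
    -- The norm form of the residue field `𝔽₂₅` over `𝔽₅`; being multiplicative and anisotropic, it
    -- shows that the quotient has no zero divisors.
    have aniso : ∀ a b : ZMod 5, a ^ 2 - a * b + b ^ 2 = 0 → a = 0 ∧ b = 0 := by decide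
    have h5 : (5 : ZMod 5) = 0 := by decide
    rw [lam_dvd_iff] at *
    rw [lam_dvd_iff]
    simp only [mul_m, mul_n, mul_k, mul_l] at h
    push_cast at h ⊢
    set a : ZMod 5 := (x.m : ZMod 5) + 3 * x.n with ha
    set b : ZMod 5 := (x.k : ZMod 5) + 3 * x.l with hb
    set c : ZMod 5 := (y.m : ZMod 5) + 3 * y.n with hc
    set d : ZMod 5 := (y.k : ZMod 5) + 3 * y.l with hd
    have h1 : a * d + b * c - b * d = 0 := by
      rw [← h.1, ha, hb, hc, hd]
      linear_combination (2 * (x.n : ZMod 5) * y.l + 2 * x.l * y.n - 2 * x.l * y.l) * h5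
    have h2 : a * d + b * c - a * c = 0 := by
      rw [← h.2, ha, hb, hc, hd]
      linear_combination (2 * (x.n : ZMod 5) * y.l + 2 * x.l * y.n - 2 * x.n * y.n) * h5
    have h3 : (a ^ 2 - a * b + b ^ 2) * (c ^ 2 - c * d + d ^ 2) = 0 := by
      have : (a ^ 2 - a * b + b ^ 2) * (c ^ 2 - c * d + d ^ 2) =
        (a * d + b * c - b * d) ^ 2 - (a * d + b * c - b * d) * (a * d + b * c - a * c) +
        (a * d + b * c - a * c) ^ 2 := by ring
      rw [this, h1, h2]; ring
    have : Fact (Nat.Prime 5) := ⟨by norm_num⟩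
    rcases mul_eq_zero.mp h3 with h | h
    · exact Or.inl (aniso _ _ h)
    · exact Or.inr (aniso _ _ h)

/-! ### Valuations -/

/-- The prime `ϖ` divides `x` exactly `k` times. -/
def Val (ϖ x : Cyc) (k : ℕ) : Prop := ∃ r, x = ϖ ^ k * r ∧ ¬ ϖ ∣ r

lemma Val.unique {ϖ x : Cyc} {k l : ℕ} (hϖ : Prime ϖ) (h : Val ϖ x k) (h' : Val ϖ x l) : k = l := by
  wlog hkl : k ≤ l generalizing k l
  · exact (this h' h (le_of_not_ge hkl)).symm
  obtain ⟨r, rfl, hr⟩ := h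
  obtain ⟨r', hr', -⟩ := h'
  by_contra hne
  obtain ⟨t, rfl⟩ := Nat.exists_eq_add_of_lt (lt_of_le_of_ne hkl hne)
  apply hr
  rw [show k + t + 1 = k + (t + 1) by ring, pow_add, mul_assoc] at hr'
  have := mul_left_cancel₀ (pow_ne_zero k hϖ.ne_zero) hr'
  exact ⟨ϖ ^ t * r', by rw [this]; ring⟩

lemma Val.mul {ϖ x y : Cyc} {k l : ℕ} (hϖ : Prime ϖ) (h : Val ϖ x k) (h' : Val ϖ y l) :
    Val ϖ (x * y) (k + l) := by
  obtain ⟨r, rfl, hr⟩ := h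
  obtain ⟨r', rfl, hr'⟩ := h'
  exact ⟨r * r', by ring, fun h => (hϖ.dvd_or_dvd h).elim hr hr'⟩

lemma val_zero_of_not_dvd {ϖ x : Cyc} (h : ¬ ϖ ∣ x) : Val ϖ x 0 := ⟨x, by simp, h⟩

lemma val_self {ϖ : Cyc} (hϖ : Prime ϖ) : Val ϖ ϖ 1 :=
  ⟨1, by simp, fun h => hϖ.not_isUnit (isUnit_of_dvd_one h)⟩

lemma Val.pow {ϖ x : Cyc} {k : ℕ} (hϖ : Prime ϖ) (h : Val ϖ x k) (n : ℕ) :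
    Val ϖ (x ^ n) (n * k) := by
  induction n with
  | zero =>
    rw [pow_zero, zero_mul]
    exact val_zero_of_not_dvd fun h => hϖ.not_isUnit (isUnit_of_dvd_one h)
  | succ n ih =>
    rw [pow_succ, add_mul, one_mul]
    exact ih.mul hϖ h

lemma Val.unit {ϖ : Cyc} (hϖ : Prime ϖ) (u : Cycˣ) : Val ϖ (u : Cyc) 0 :=
  val_zero_of_not_dvd fun h => hϖ.not_isUnit (isUnit_of_dvd_unit h u.isUnit)

lemma Val.Z_pow {ϖ : Cyc} (hϖ : Prime ϖ) (i : ℕ) : Val ϖ (Z ^ i) 0 := by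
  have := Val.unit hϖ (Zu ^ i)
  rwa [Units.val_pow_eq_pow_val] at this

lemma Val.prod {ϖ A B C D : Cyc} {i j k l : ℕ} (hϖ : Prime ϖ) (hA : Val ϖ A i) (hB : Val ϖ B j)
    (hC : Val ϖ C k) (hD : Val ϖ D l) (a b c d : ℕ) :
    Val ϖ (A ^ a * B ^ b * (C ^ c * D ^ d)) ((a * i + b * j) + (c * k + d * l)) :=
  ((hA.pow hϖ a).mul hϖ (hB.pow hϖ b)).mul hϖ ((hC.pow hϖ c).mul hϖ (hD.pow hϖ d))

lemma val_lam_tau_lam : Val lam (τ lam) 0 :=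
  val_zero_of_not_dvd (by rw [lam_dvd_iff]; decide)
lemma val_lam_pr : Val lam pr 0 := val_zero_of_not_dvd (by rw [lam_dvd_iff]; decide)
lemma val_lam_tau_pr : Val lam (τ pr) 0 := val_zero_of_not_dvd (by rw [lam_dvd_iff]; decide)
lemma val_lam_sigma_pr : Val lam (σ pr) 0 := val_zero_of_not_dvd (by rw [lam_dvd_iff]; decide)
lemma val_lam_eta_pr : Val lam (η pr) 0 := val_zero_of_not_dvd (by rw [lam_dvd_iff]; decide)
lemma val_pr_lam : Val pr lam 0 :=
  val_zero_of_not_dvd (by rw [pr_dvd_iff, redPr_apply]; decide)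
lemma val_pr_tau_lam : Val pr (τ lam) 0 :=
  val_zero_of_not_dvd (by rw [pr_dvd_iff, redPr_apply]; decide)
lemma val_pr_tau_pr : Val pr (τ pr) 0 :=
  val_zero_of_not_dvd (by rw [pr_dvd_iff, redPr_apply]; decide)
lemma val_pr_sigma_pr : Val pr (σ pr) 0 :=
  val_zero_of_not_dvd (by rw [pr_dvd_iff, redPr_apply]; decide)
lemma val_pr_eta_pr : Val pr (η pr) 0 :=
  val_zero_of_not_dvd (by rw [pr_dvd_iff, redPr_apply]; decide)

lemma σ_lam : σ lam = lam := by decide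
lemma η_lam : η lam = τ lam := by decide

/-! ### The norm to the Eisenstein integers and signatures -/

/-- The relative norm to the ring of Eisenstein integers. -/
def γ (x : Cyc) : Cyc := x * η x

lemma γ_mul (x y : Cyc) : γ (x * y) = γ x * γ y := by unfold γ; rw [map_mul]; ring

lemma γ_pow (x : Cyc) (n : ℕ) : γ (x ^ n) = γ x ^ n := by unfold γ; rw [map_pow]; ring

lemma Val.γ {ϖ x : Cyc} {k l : ℕ} (hϖ : Prime ϖ) (h : Val ϖ x k) (h' : Val ϖ (η x) l) :
    Val ϖ (γ x) (k + l) := h.mul hϖ h'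

lemma Val.τ_γ {ϖ x : Cyc} {k l : ℕ} (hϖ : Prime ϖ) (h : Val ϖ (τ x) k) (h' : Val ϖ (σ x) l) :
    Val ϖ (τ (Cyc.γ x)) (k + l) := by
  rw [Cyc.γ, map_mul, τη]
  exact h.mul hϖ h'

lemma γ_eq (x : Cyc) : γ x = ⟨U x - W x, 0, V x - W x, 0⟩ := by
  ext <;> simp [γ, U, V, W] <;> ring

/-- Both are `(2 + i)(2 - i) = 5`. This is why exchanging `λ` with its conjugate changes the element
but not the sides. -/
lemma γ_tau_lam : γ (τ lam) = γ lam := by decide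

lemma sg_eq_of_γ_eq {x y : Cyc} (hp : p x = p y) (h : γ x = γ y) : sg x = sg y := by
  have h1 := two_p x; have h2 := two_p y
  rw [γ_eq, γ_eq, Cyc.ext_iff] at h
  simp only [true_and, and_true] at h
  have hU : U x = U y := by omega
  have hV : V x = V y := by omega
  have hW : W x = W y := by omega
  simp only [sg, lo, mid, hi, hU, hV, hW]

lemma perm_of_sides_eq {x y : Cyc} (h : lo x = lo y ∧ mid x = mid y ∧ hi x = hi y) :
    (U y = U x ∧ V y = V x ∧ W y = W x) ∨ (U y = W x ∧ V y = U x ∧ W y = V x) ∨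
    (U y = V x ∧ V y = W x ∧ W y = U x) ∨ (U y = V x ∧ V y = U x ∧ W y = W x) ∨
    (U y = W x ∧ V y = V x ∧ W y = U x) ∨ (U y = U x ∧ V y = W x ∧ W y = V x) := by
  unfold lo mid hi at h
  generalize U x = a at *
  generalize V x = b at *
  generalize W x = c at *
  generalize U y = d at *
  generalize V y = e at *
  generalize W y = f at *
  rcases le_total a b with h1 | h1 <;> rcases le_total b c with h2 | h2 <;>
    rcases le_total a c with h3 | h3 <;> rcases le_total d e with h4 | h4 <;>
    rcases le_total e f with h5 | h5 <;> rcases le_total d f with h6 | h6 <;>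
    simp only [h1, h2, h3, h4, h5, h6, min_eq_left, min_eq_right, max_eq_left, max_eq_right] at h <;>
    omega

/-- The unordered sides agree; a cyclic permutation multiplies `γ` by a power of `ζ⁴`, and a
transposition also conjugates it. -/
lemma γ_of_sg_eq {x y : Cyc} (hp : p x = p y) (h : sg x = sg y) :
    ∃ i : ℕ, γ y = Z ^ i * γ x ∨ γ y = Z ^ i * τ (γ x) := by
  rw [γ_eq, γ_eq]
  rcases perm_of_sides_eq (sides_eq_of_sg hp h) with h | h | h | h | h | h <;>
    obtain ⟨h1, h2, h3⟩ := h <;> rw [h1, h2, h3]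
  · exact ⟨0, Or.inl (by simp)⟩
  · exact ⟨4, Or.inl (by ext <;> simp [pow_succ])⟩
  · exact ⟨8, Or.inl (by ext <;> simp [pow_succ])⟩
  · exact ⟨0, Or.inr (by ext <;> simp)⟩
  · exact ⟨4, Or.inr (by ext <;> simp [pow_succ])⟩
  · exact ⟨8, Or.inr (by ext <;> simp [pow_succ])⟩

/-! ### Elements of a given relative norm -/

/-- The prime divides `w` or `τ w`, and in the second case its conjugate divides `w`. -/
lemma exists_split {ϖ w c : Cyc} (hϖ : Prime ϖ) (h : w * τ w = ϖ * τ ϖ * c) :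
    ∃ w', (w = ϖ * w' ∨ w = τ ϖ * w') ∧ w' * τ w' = c := by
  have hτ : τ ϖ ≠ 0 := fun h0 => hϖ.ne_zero (by rw [← ττ ϖ, h0, map_zero])
  have hdvd : ϖ ∣ w * τ w := ⟨τ ϖ * c, by rw [h]; ring⟩
  rcases hϖ.dvd_or_dvd hdvd with ⟨w', hw⟩ | ⟨w', hw⟩
  · refine ⟨w', Or.inl hw, mul_left_cancel₀ (mul_ne_zero hϖ.ne_zero hτ) ?_⟩
    rw [← h, hw, map_mul]; ring
  · have hw' : w = τ ϖ * τ w' := by rw [← map_mul, ← hw, ττ]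
    refine ⟨τ w', Or.inr hw', mul_left_cancel₀ (mul_ne_zero hϖ.ne_zero hτ) ?_⟩
    rw [← h, hw', map_mul, ττ, ττ]; ring

lemma exists_split_pow {ϖ : Cyc} (hϖ : Prime ϖ) (n : ℕ) : ∀ {w c : Cyc},
    w * τ w = (ϖ * τ ϖ) ^ n * c →
    ∃ a ≤ n, ∃ w', w = ϖ ^ a * τ ϖ ^ (n - a) * w' ∧ w' * τ w' = c := by
  induction n with
  | zero => intro w c h; exact ⟨0, le_rfl, w, by simp, by simpa using h⟩
  | succ n ih =>
    intro w c h
    rw [pow_succ', mul_assoc] at h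
    obtain ⟨w₁, hw, h₁⟩ := exists_split hϖ h
    obtain ⟨a, ha, w', hw', h'⟩ := ih h₁
    rcases hw with rfl | rfl
    · refine ⟨a + 1, by omega, w', ?_, h'⟩
      rw [hw', show n + 1 - (a + 1) = n - a by omega]; ring
    · refine ⟨a, by omega, w', ?_, h'⟩
      rw [hw', show n + 1 - a = (n - a) + 1 by omega]; ring

/-! ### Words in the two primes: norms, signatures and classes -/

/-- The products of powers of the primes over 5 and 13. -/
def word (n m a b : ℕ) : Cyc := lam ^ a * τ lam ^ (n - a) * (pr ^ b * τ pr ^ (m - b))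

lemma word_ne_zero (n m a b : ℕ) : word n m a b ≠ 0 := by
  have h1 : τ lam ≠ 0 := by decide
  have h2 : τ pr ≠ 0 := by decide
  exact mul_ne_zero (mul_ne_zero (pow_ne_zero _ prime_lam.ne_zero) (pow_ne_zero _ h1))
    (mul_ne_zero (pow_ne_zero _ prime_pr.ne_zero) (pow_ne_zero _ h2))

lemma word_mul_τ {n m a b : ℕ} (ha : a ≤ n) (hb : b ≤ m) :
    word n m a b * τ (word n m a b) = (lam * τ lam) ^ n * (pr * τ pr) ^ m := by
  obtain ⟨a', rfl⟩ := Nat.exists_eq_add_of_le ha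
  obtain ⟨b', rfl⟩ := Nat.exists_eq_add_of_le hb
  simp only [word, map_mul, map_pow, ττ, Nat.add_sub_cancel_left]
  ring

lemma sameNorm_iff {x y : Cyc} : SameNorm x y ↔ y * τ y = x * τ x := by
  rw [mul_τ_eq_iff]; rfl

lemma sameNorm_word {n m a b a' b' : ℕ} (ha : a ≤ n) (hb : b ≤ m) (ha' : a' ≤ n) (hb' : b' ≤ m) :
    SameNorm (word n m a b) (word n m a' b') := by
  rw [sameNorm_iff, word_mul_τ ha hb, word_mul_τ ha' hb']

/-- Splitting off the primes one at a time leaves an element of relative norm 1, hence torsion. So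
the words exhaust their relative norm. -/
lemma exists_word {n m : ℕ} {w : Cyc} (h : SameNorm (word n m n m) w) :
    ∃ (i a b : ℕ), a ≤ n ∧ b ≤ m ∧ w = Z ^ i * word n m a b := by
  rw [sameNorm_iff, word_mul_τ le_rfl le_rfl] at h
  obtain ⟨a, ha, w₁, rfl, h₁⟩ := exists_split_pow prime_lam n h
  rw [← mul_one ((pr * τ pr) ^ m)] at h₁
  obtain ⟨b, hb, w₂, rfl, h₂⟩ := exists_split_pow prime_pr m h₁
  have h1 : w₂ * τ w₂ = 1 * τ 1 := by rw [h₂, map_one, one_mul]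
  rw [mul_τ_eq_iff, p_one, q_one] at h1
  obtain ⟨i, rfl⟩ := eq_Z_pow h1.1 h1.2
  exact ⟨i, a, b, ha, hb, by unfold word; ring⟩

lemma γ_word {n : ℕ} (m : ℕ) {a : ℕ} (b : ℕ) (ha : a ≤ n) :
    γ (word n m a b) = γ lam ^ n * (γ pr ^ b * γ (τ pr) ^ (m - b)) := by
  rw [word, γ_mul, γ_mul, γ_mul, γ_pow, γ_pow, γ_pow, γ_pow, γ_tau_lam, ← pow_add,
    Nat.add_sub_cancel' ha]

lemma val_pr_γ_word {n m a b : ℕ} (ha : a ≤ n) : Val pr (γ (word n m a b)) b := by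
  rw [γ_word m b ha]
  have h1 : Val pr (γ lam) (0 + 0) :=
    Val.γ prime_pr val_pr_lam (by rw [η_lam]; exact val_pr_tau_lam)
  have h2 : Val pr (γ pr) (1 + 0) := Val.γ prime_pr (val_self prime_pr) val_pr_eta_pr
  have h3 : Val pr (γ (τ pr)) (0 + 0) :=
    Val.γ prime_pr val_pr_tau_pr (by rw [ητ]; exact val_pr_sigma_pr)
  have h := (h1.pow prime_pr n).mul prime_pr ((h2.pow prime_pr b).mul prime_pr (h3.pow prime_pr (m - b)))
  simp only [add_zero, mul_zero, mul_one, zero_add] at h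
  exact h

lemma val_pr_τ_γ_word {n m a b : ℕ} (ha : a ≤ n) : Val pr (τ (γ (word n m a b))) (m - b) := by
  rw [γ_word m b ha]
  simp only [map_mul, map_pow]
  have h1 : Val pr (τ (γ lam)) (0 + 0) :=
    Val.τ_γ prime_pr val_pr_tau_lam (by rw [← τη, η_lam, ττ]; exact val_pr_lam)
  have h2 : Val pr (τ (γ pr)) (0 + 0) := Val.τ_γ prime_pr val_pr_tau_pr val_pr_sigma_pr
  have h3 : Val pr (τ (γ (τ pr))) (1 + 0) :=
    Val.τ_γ prime_pr (by rw [ττ]; exact val_self prime_pr) (by rw [στ]; exact val_pr_eta_pr)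
  have h := (h1.pow prime_pr n).mul prime_pr ((h2.pow prime_pr b).mul prime_pr (h3.pow prime_pr (m - b)))
  simp only [add_zero, mul_zero, mul_one, zero_add] at h
  exact h

/-- The signature fixes `γ` up to torsion and conjugation, and `pr` occurs `b` times in `γ` and `m -
b` times in its conjugate. -/
lemma eq_or_eq_of_sg_word {n m a b a' b' : ℕ} (ha : a ≤ n) (hb : b ≤ m) (ha' : a' ≤ n)
    (hb' : b' ≤ m) (h : sg (word n m a b) = sg (word n m a' b')) : b' = b ∨ b' = m - b := by
  obtain ⟨i, hi | hi⟩ := γ_of_sg_eq (sameNorm_word ha' hb' ha hb).1 h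
  · left
    have h1 := val_pr_γ_word (m := m) (b := b') ha'
    rw [hi] at h1
    simpa using h1.unique prime_pr ((Val.Z_pow prime_pr i).mul prime_pr (val_pr_γ_word ha))
  · right
    have h1 := val_pr_γ_word (m := m) (b := b') ha'
    rw [hi] at h1
    simpa using h1.unique prime_pr ((Val.Z_pow prime_pr i).mul prime_pr (val_pr_τ_γ_word ha))

lemma sg_word_eq {n m a a' b : ℕ} (ha : a ≤ n) (hb : b ≤ m) (ha' : a' ≤ n) :
    sg (word n m a b) = sg (word n m a' b) :=
  sg_eq_of_γ_eq (sameNorm_word ha' hb ha hb).1 (by rw [γ_word m b ha, γ_word m b ha'])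

lemma uniqueSg_word (n : ℕ) : UniqueSg (word n 0 n 0) := by
  intro w w' hw hw'
  obtain ⟨i, a, b, ha, hb, rfl⟩ := exists_word hw
  obtain ⟨i', a', b', ha', hb', rfl⟩ := exists_word hw'
  obtain rfl : b = 0 := by omega
  obtain rfl : b' = 0 := by omega
  rw [sg_Z_pow, sg_Z_pow, sg_word_eq ha hb ha']

lemma not_uniqueSg_word (n : ℕ) {m : ℕ} (hm : 2 ≤ m) : ¬ UniqueSg (word n m n m) := by
  intro h
  have h1 := h (word n m n m) (word n m n (m - 1)) (sameNorm_word le_rfl le_rfl le_rfl le_rfl)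
    (sameNorm_word le_rfl le_rfl le_rfl (by omega))
  have := eq_or_eq_of_sg_word le_rfl le_rfl le_rfl (by omega) h1
  omega

lemma uniqueElt_word (m : ℕ) : UniqueElt (word 0 m 0 m) := by
  intro w w' hw hw' hs
  obtain ⟨i, a, b, ha, hb, rfl⟩ := exists_word hw
  obtain ⟨i', a', b', ha', hb', rfl⟩ := exists_word hw'
  rw [sg_Z_pow, sg_Z_pow] at hs
  obtain rfl : a = 0 := by omega
  obtain rfl : a' = 0 := by omega
  obtain ⟨j, hj⟩ := Z_pow_inv i
  rcases eq_or_eq_of_sg_word ha hb ha' hb' hs with rfl | rfl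
  · refine ⟨i' + j, Or.inl ?_⟩
    linear_combination (-Z ^ i' * word 0 m 0 b') * hj
  · obtain ⟨j, hj⟩ := Z_pow_inv (11 * i)
    refine ⟨i' + j, Or.inr ?_⟩
    have : τ (word 0 m 0 b) = word 0 m 0 (m - b) := by
      simp only [word, map_mul, map_pow, ττ, Nat.sub_sub_self hb]; ring
    rw [map_mul, this, map_pow, τ_Z, ← pow_mul]
    linear_combination (-Z ^ i' * word 0 m 0 (m - b)) * hj

/-! ### Valuations of words and of their Galois conjugates -/

lemma val_lam_word (n m a b : ℕ) : Val lam (word n m a b) a := by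
  simpa [word] using Val.prod prime_lam (val_self prime_lam) val_lam_tau_lam val_lam_pr val_lam_tau_pr
    a (n - a) b (m - b)

lemma val_lam_τ_word (n m a b : ℕ) : Val lam (τ (word n m a b)) (n - a) := by
  have := Val.prod prime_lam val_lam_tau_lam (val_self prime_lam) val_lam_tau_pr val_lam_pr
    a (n - a) b (m - b)
  simpa [word] using this

lemma val_lam_σ_word (n m a b : ℕ) : Val lam (σ (word n m a b)) a := by
  have h : σ (τ lam) = τ lam := by decide
  have := Val.prod prime_lam (val_self prime_lam) val_lam_tau_lam val_lam_sigma_pr val_lam_eta_pr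
    a (n - a) b (m - b)
  simpa [word, h, σ_lam, στ] using this

lemma val_lam_η_word (n m a b : ℕ) : Val lam (η (word n m a b)) (n - a) := by
  have h : η (τ lam) = lam := by decide
  have := Val.prod prime_lam val_lam_tau_lam (val_self prime_lam) val_lam_eta_pr val_lam_sigma_pr
    a (n - a) b (m - b)
  simpa [word, h, η_lam, ητ] using this

lemma val_pr_word (n m a b : ℕ) : Val pr (word n m a b) b := by
  simpa [word] using Val.prod prime_pr val_pr_lam val_pr_tau_lam (val_self prime_pr) val_pr_tau_pr
    a (n - a) b (m - b)

lemma val_pr_τ_word (n m a b : ℕ) : Val pr (τ (word n m a b)) (m - b) := by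
  have := Val.prod prime_pr val_pr_tau_lam val_pr_lam val_pr_tau_pr (val_self prime_pr)
    a (n - a) b (m - b)
  simpa [word] using this

lemma val_pr_σ_word (n m a b : ℕ) : Val pr (σ (word n m a b)) 0 := by
  have h : σ (τ lam) = τ lam := by decide
  have := Val.prod prime_pr val_pr_lam val_pr_tau_lam val_pr_sigma_pr val_pr_eta_pr
    a (n - a) b (m - b)
  simpa [word, h, σ_lam, στ] using this

lemma val_pr_η_word (n m a b : ℕ) : Val pr (η (word n m a b)) 0 := by
  have h : η (τ lam) = lam := by decide
  have := Val.prod prime_pr val_pr_tau_lam val_pr_lam val_pr_eta_pr val_pr_sigma_pr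
    a (n - a) b (m - b)
  simpa [word, h, η_lam, ητ] using this

lemma not_uniqueElt_word {n : ℕ} (hn : 2 ≤ n) (m : ℕ) : ¬ UniqueElt (word n m n m) := by
  intro h
  -- At `lam` the valuation `n - 1` must differ from `n` and from the conjugate's `0`; the latter
  -- needs `n ≥ 2`.
  obtain ⟨i, hi | hi⟩ := h (word n m n m) (word n m (n - 1) m)
    (sameNorm_word le_rfl le_rfl le_rfl le_rfl) (sameNorm_word le_rfl le_rfl (by omega) le_rfl)
    (sg_word_eq le_rfl le_rfl (by omega))
  · have h1 := val_lam_word n m (n - 1) m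
    rw [hi] at h1
    have := h1.unique prime_lam ((Val.Z_pow prime_lam i).mul prime_lam (val_lam_word n m n m))
    omega
  · have h1 := val_lam_word n m (n - 1) m
    rw [hi] at h1
    have := h1.unique prime_lam ((Val.Z_pow prime_lam i).mul prime_lam (val_lam_τ_word n m n m))
    omega

end Cyc

/-! ### Large families -/

lemma Cyc.Val.of_associated {ϖ x y : Cyc} {k : ℕ} (hϖ : Prime ϖ) (h : Associated x y)
    (hx : Val ϖ x k) : Val ϖ y k := by
  obtain ⟨u, rfl⟩ := h
  simpa using hx.mul hϖ (Val.unit hϖ u)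

/-- Elements that are told apart by the valuations of all their conjugates give cosets without
congruent triangles. -/
lemma exists_incongruent_cosets {F : Set Coset} {ϖ : Cyc} (hϖ : Prime ϖ) {N : ℕ} {e : ℕ → Cyc}
    {v₁ v₂ v₃ v₄ : ℕ → ℕ} (hF : ∀ t < N, cos (e t) ∈ F) (h₁ : ∀ t, Val ϖ (e t) (v₁ t))
    (h₂ : ∀ t, Val ϖ (τ (e t)) (v₂ t)) (h₃ : ∀ t, Val ϖ (σ (e t)) (v₃ t))
    (h₄ : ∀ t, Val ϖ (η (e t)) (v₄ t))
    (hne : ∀ t < N, ∀ s < N, t ≠ s → v₁ s ≠ v₁ t ∧ v₁ s ≠ v₂ t ∧ v₁ s ≠ v₃ t ∧ v₁ s ≠ v₄ t) :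
    ∃ S : Finset Coset, (S : Set Coset) ⊆ F ∧ N ≤ S.card ∧
      ∀ c ∈ S, ∀ c' ∈ S, c ≠ c' →
        ¬ ∃ T T' : Tri, coset T = c ∧ coset T' = c' ∧ Z2Congruent T T' := by
  classical
  refine ⟨(Finset.range N).image fun t => cos (e t), ?_, ?_, ?_⟩
  · intro c hc
    rw [Finset.mem_coe, Finset.mem_image] at hc
    obtain ⟨t, ht, rfl⟩ := hc
    exact hF t (Finset.mem_range.mp ht)
  · rw [Finset.card_image_of_injOn, Finset.card_range]
    intro t ht s hs hts
    by_contra hn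
    have ht' := Finset.mem_range.mp (Finset.mem_coe.mp ht)
    have hs' := Finset.mem_range.mp (Finset.mem_coe.mp hs)
    exact (hne t ht' s hs' hn).1
      ((h₁ s).unique hϖ ((h₁ t).of_associated hϖ (cos_eq_iff.mp hts)))
  · intro c hc c' hc' hcc
    rw [Finset.mem_image] at hc hc'
    obtain ⟨t, ht, rfl⟩ := hc
    obtain ⟨s, hs, rfl⟩ := hc'
    rw [Finset.mem_range] at ht hs
    have hts : t ≠ s := by rintro rfl; exact hcc rfl
    obtain ⟨n₁, n₂, n₃, n₄⟩ := hne t ht s hs hts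
    rintro ⟨T, T', hT, hT', hcong⟩
    rw [coset_eq, cos_eq_iff] at hT hT'
    have key : ∀ f : Cyc →+* Cyc, ∀ i : ℕ, E T' = Z ^ i * f (E T) →
        ∀ k, Val ϖ (f (e t)) k → v₁ s = k := by
      intro f i h k hk
      have a1 : Associated (f (e t)) (f (E T)) := (hT.symm).map f
      have a2 := (hk.of_associated hϖ a1)
      have a3 := (Val.Z_pow hϖ i).mul hϖ a2
      rw [← h, zero_add] at a3
      exact (h₁ s).unique hϖ (a3.of_associated hϖ hT')
    obtain ⟨i, h | h | h | h⟩ := z2Congruent_iff.mp hcong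
    · exact n₁ (key (RingHom.id _) i h _ (h₁ t))
    · exact n₂ (key τ i h _ (h₂ t))
    · exact n₃ (key σ i h _ (h₃ t))
    · exact n₄ (key η i h _ (h₄ t))

lemma cos_word_mem {n m a b : ℕ} (ha : a ≤ n) (hb : b ≤ m) :
    cos (word n m a b) ∈ Fam (word n m n m) := by
  rw [cos_mem_Fam]
  have h := sameNorm_word (le_refl n) (le_refl m) ha hb
  exact Sim.rel ⟨h.1, by rw [h.2]⟩

lemma exists_cosets_of_lam (N m : ℕ) :
    ∃ S : Finset Coset, (S : Set Coset) ⊆ Fam (word (2 * N + 2) m (2 * N + 2) m) ∧ N ≤ S.card ∧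
      ∀ c ∈ S, ∀ c' ∈ S, c ≠ c' →
        ¬ ∃ T T' : Tri, coset T = c ∧ coset T' = c' ∧ Z2Congruent T T' :=
  -- The Galois group only exchanges `t` with `2N + 2 - t`, so exponents below `N` are never
  -- confused.
  exists_incongruent_cosets prime_lam (e := fun t => word (2 * N + 2) m t m)
    (fun t ht => cos_word_mem (by omega) le_rfl) (fun t => val_lam_word _ _ _ _)
    (fun t => val_lam_τ_word _ _ _ _) (fun t => val_lam_σ_word _ _ _ _)
    (fun t => val_lam_η_word _ _ _ _) (by intro t ht s hs hts; omega)

lemma exists_cosets_of_pr (N : ℕ) :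
    ∃ S : Finset Coset, (S : Set Coset) ⊆ Fam (word 0 (2 * N + 2) 0 (2 * N + 2)) ∧ N ≤ S.card ∧
      ∀ c ∈ S, ∀ c' ∈ S, c ≠ c' →
        ¬ ∃ T T' : Tri, coset T = c ∧ coset T' = c' ∧ Z2Congruent T T' :=
  -- The exponent starts at 1 because the images under `σ` and `η` have valuation 0 at `pr`.
  exists_incongruent_cosets prime_pr (e := fun t => word 0 (2 * N + 2) 0 (t + 1))
    (fun t ht => cos_word_mem le_rfl (by omega)) (fun t => val_pr_word _ _ _ _)
    (fun t => val_pr_τ_word _ _ _ _) (fun t => val_pr_σ_word _ _ _ _)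
    (fun t => val_pr_η_word _ _ _ _) (by intro t ht s hs hts; omega)

theorem exists_large_family (K : DClass) (hK : K ≠ DClass.A) (N : ℕ) :
    ∃ x : Cyc, x ≠ 0 ∧ EltClass K x ∧
      ∃ S : Finset Coset, (S : Set Coset) ⊆ Fam x ∧ N ≤ S.card ∧
        ∀ c ∈ S, ∀ c' ∈ S, c ≠ c' →
          ¬ ∃ T T' : Tri, coset T = c ∧ coset T' = c' ∧ Z2Congruent T T' := by
  cases K with
  | A => exact absurd rfl hK
  | B0 => exact ⟨_, word_ne_zero _ _ _ _, ⟨uniqueSg_word _, not_uniqueElt_word (by omega) 0⟩,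
      exists_cosets_of_lam N 0⟩
  | B1 => exact ⟨_, word_ne_zero _ _ _ _, ⟨not_uniqueSg_word 0 (by omega), uniqueElt_word _⟩,
      exists_cosets_of_pr N⟩
  | B2 => exact ⟨_, word_ne_zero _ _ _ _,
      ⟨not_uniqueSg_word _ le_rfl, not_uniqueElt_word (by omega) 2⟩, exists_cosets_of_lam N 2⟩

theorem exists_eltClass_elt (K : DClass) : ∃ x : Cyc, x ≠ 0 ∧ EltClass K x := by
  by_cases hK : K = DClass.A
  · subst hK
    -- The empty word is 1; only torsion units share its relative norm.
    exact ⟨word 0 0 0 0, word_ne_zero _ _ _ _, uniqueSg_word 0, uniqueElt_word 0⟩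
  · obtain ⟨x, hx, h, -⟩ := exists_large_family K hK 0
    exact ⟨x, hx, h⟩

end HardCore

end

open HardCore
theorem theorem3 :
    -- each class is infinite
    (∀ K : DClass, {d : ℕ | InClass K d}.Infinite) ∧
    -- each non-sliding value lies in exactly one class
    (∀ d : ℕ, Attainable d → ¬ Sliding d → ∃! K : DClass, InClass K d) ∧
    -- triangles with a vertex at the origin are identified with the elements of the ring
    (∀ β : ZZeta, ∃! p : (ℤ × ℤ) × (ℤ × ℤ), elt ![(0, 0), p.1, p.2] = β) ∧
    -- triangles that differ by a torsion unit are congruent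
    (∀ (T T' : Tri) (i : ℕ), elt T' = zeta ^ i * elt T → Z2Congruent T T') ∧
    -- each nonzero coset is a double sequence of triangles
    (∀ c : Coset, c ≠ 0 → ∃ x : ℤ → Tri, IsIndexation c x) ∧
    (∀ (c : Coset) (x : ℤ → Tri), c ≠ 0 → IsIndexation c x →
      -- every triangle of the coset occurs exactly once, up to torsion units
      (∀ T : Tri, coset T = c → ∃! j : ℤ, ∃ i : ℕ, elt T = zeta ^ i * elt (x j)) ∧
      -- the signatures alternate
      (∃ a b : ℤ, ∀ j : ℤ, signature (x j) = if Even j then (a, b) else (b, a)) ∧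
      -- only finitely many members are not M-triangles
      {j : ℤ | ¬ IsMTri (x j)}.Finite) ∧
    -- the cosets are partitioned into maximal families
    (∀ c : Coset, c ≠ 0 → ∃! F : Set Coset, IsMaxFamily F ∧ c ∈ F) ∧
    -- families are finite, have infinitely many values `D_j²`, and belong to one class
    (∀ F : Set Coset, IsMaxFamily F →
      F.Finite ∧
      (∀ X, IsCompatible F X → {d : ℕ | ∃ j : ℤ, IsLeast (shortSides F X j) d}.Infinite) ∧
      ∃! K : DClass, FamilyOfClass F K) ∧
    -- every class occurs
    (∀ K : DClass, ∃ F : Set Coset, IsMaxFamily F ∧ FamilyOfClass F K) ∧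
    -- families of each of the Classes B0, B1, B2 are arbitrarily large, even when cosets that
    -- contain congruent triangles are counted once
    (∀ K : DClass, K ≠ DClass.A → ∀ N : ℕ, ∃ F : Set Coset, IsMaxFamily F ∧ FamilyOfClass F K ∧
      ∃ G : Finset Coset, (G : Set Coset) ⊆ F ∧ N ≤ G.card ∧
        ∀ c ∈ G, ∀ c' ∈ G, c ≠ c' →
          ¬ ∃ T T' : Tri, coset T = c ∧ coset T' = c' ∧ Z2Congruent T T') := by
  refine ⟨fun K => ?_, existsUnique_inClass, existsUnique_elt, fun T T' i h => ?_,
    fun c _ => exists_isIndexation c,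
    fun c x hc hx => ⟨fun T hT => hx.existsUnique hc T hT, hx.signature_eq, hx.finite_not_isMTri hc⟩,
    existsUnique_isMaxFamily, fun F hF => ⟨?_, ?_, existsUnique_familyOfClass hF⟩, fun K => ?_,
    fun K hK N => ?_⟩
  · obtain ⟨x, hx, h⟩ := exists_eltClass_elt K
    exact (familyOfClass_Fam h).infinite_inClass hx
  · exact z2_of_Z_pow i ((elt_eq_iff T T' i).mp h)
  · obtain ⟨x, -, rfl⟩ := hF.exists_eq_Fam
    exact finite_Fam x
  · intro X hX
    obtain ⟨x, -, rfl⟩ := hF.exists_eq_Fam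
    exact infinite_shortSides hX
  · obtain ⟨x, hx, h⟩ := exists_eltClass_elt K
    exact ⟨Fam x, isMaxFamily_Fam hx, familyOfClass_Fam h⟩
  · obtain ⟨x, hx, h, hS⟩ := exists_large_family K hK N
    exact ⟨Fam x, isMaxFamily_Fam hx, familyOfClass_Fam h, hS⟩
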